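/- For $d\in\mathbb N$ let $\mathcal T_d$ be the infinite rooted $d$-ary tree, with vertices the finite words over an alphabet $X_d$ of $d$ letters and edges $(u,ux)$, $x\in X_d$. For $f\in\operatorname{Aut}(\mathcal T_d)$ and a vertex $u$, the state $f^u\in\operatorname{Aut}(\mathcal T_d)$ is defined by $f(uv)=f(u)f^u(v)$ for all words $v$; a subgroup $G\le\operatorname{Aut}(\mathcal T_d)$ is self-similar if it contains all states of its elements. A homomorphism $r\colon G\to Q$ is a retraction if $r\circ i=\mathrm{id}_Q$ for some homomorphism $i\colon Q\to G$; a retraction of a self-similar group $G$ is persistent if $r(g^u)=r(g)$ for all $g\in G$ and all vertices $u$. For a self-similar $G\le\operatorname{Aut}(\mathcal T_d)$, the Röver–Nekrashevych group $V_d(G)$ is the group of all homeomorphisms $h$ of the space $X_d^{\omega}$ of infinite words for which there are finite complete rooted subtrees $T_-,T_+$ of $\mathcal T_d$ (complete: with one child of a vertex they contain all of its children), a bijection $\sigma$ from the leaves of $T_+$ to the leaves of $T_-$, and elements $f_v\in G$ such that $h(vw)=\sigma(v)f_v(w)$ for all leaves $v$ of $T_+$ and all $w\in X_d^{\omega}$.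 A map $f\colon X\to Y$ of metric spaces is coarse Lipschitz if there are $C,D>0$ with $d(f(x),f(x'))\le C\,d(x,x')+D$ for all $x,x'\in X$. A finitely generated group $Q$ is a quasi-retract of a finitely generated group $\Gamma$ if, for word metrics of some finite generating sets, there are coarse Lipschitz maps $\rho\colon\Gamma\to Q$ and $\iota\colon Q\to\Gamma$ and a constant $E>0$ with $d(\rho(\iota(q)),q)\le E$ for all $q\in Q$. **Corollary.** Let $G\le\operatorname{Aut}(\mathcal T_d)$ be a finitely generated self-similar group and let $r\colon G\to Q$ be a persistent retraction. Then there are an integer $m\ge 1$ and an injective homomorphism $j\colon G\to\operatorname{Aut}(\mathcal T_{md})$ such that $j(G)\le\operatorname{Aut}(\mathcal T_{md})$ is self-similar and the Röver–Nekrashevych group $V_{md}(j(G))$ is finitely generated, has finite abelianization and admits $Q$ as a quasi-retract. -/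

import Mathlib

namespace SelfSim

/-! ### The rooted `d`-ary tree and its automorphisms -/

/-- The directed edges `(u, ux)` of the infinite rooted `d`-ary tree, whose vertices are the finite
words over the alphabet `Fin d`. -/
def TreeEdge (d : ℕ) (u v : List (Fin d)) : Prop := ∃ x : Fin d, v = u ++ [x]

/-- The automorphism group of the rooted `d`-ary tree; the product is composition of maps. -/
abbrev TreeAut (d : ℕ) : Type := TreeEdge d ≃r TreeEdge d

variable {d : ℕ}

theorem TreeAut.edge (f : TreeAut d) (u : List (Fin d)) (x : Fin d) :
    ∃ y, f (u ++ [x]) = f u ++ [y] :=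
  f.map_rel_iff.2 ⟨x, rfl⟩

theorem TreeAut.map_nil (f : TreeAut d) : f [] = [] := by
  rcases List.eq_nil_or_concat (f []) with h | ⟨u, x, h⟩
  · exact h
  · exfalso
    have h2 : TreeEdge d (f (f.symm u)) (f []) := ⟨x, by simpa using h⟩
    obtain ⟨y, hy⟩ := f.map_rel_iff.1 h2
    simp at hy

theorem TreeAut.length_map (f : TreeAut d) (u : List (Fin d)) : (f u).length = u.length := by
  induction u using List.reverseRecOn with
  | nil => simp [f.map_nil]
  | append_singleton u x ih =>
    obtain ⟨y, hy⟩ := f.edge u x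
    simp [hy, ih]

theorem TreeAut.map_append (f : TreeAut d) (u v : List (Fin d)) :
    f (u ++ v) = f u ++ (f (u ++ v)).drop u.length := by
  induction v using List.reverseRecOn with
  | nil => simp [← f.length_map u]
  | append_singleton v x ih =>
    obtain ⟨y, hy⟩ := f.edge (u ++ v) x
    rw [← List.append_assoc, hy, ih]
    have hl := f.length_map u
    simp [← hl]

/-- The state `f^u` of `f` at the vertex `u`, i.e. the automorphism with
`f (u ++ v) = f u ++ f^u v` for all words `v`. -/
def TreeAut.state (f : TreeAut d) (u : List (Fin d)) : TreeAut d where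
  toFun v := (f (u ++ v)).drop u.length
  invFun v := (f.symm (f u ++ v)).drop u.length
  left_inv v := by
    simp only
    rw [← f.map_append u v]
    simp
  right_inv v := by
    have h := TreeAut.map_append f.symm (f u) v
    rw [f.length_map, RelIso.symm_apply_apply] at h
    simp only
    rw [← h, RelIso.apply_symm_apply, ← f.length_map u]
    simp
  map_rel_iff' {v w} := by
    have hv := f.map_append u v
    have hw := f.map_append u w
    have h := f.map_rel_iff (a := u ++ v) (b := u ++ w)
    rw [hv, hw] at h
    simpa [TreeEdge] using h

theorem TreeAut.state_spec (f : TreeAut d) (u v : List (Fin d)) :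
    f (u ++ v) = f u ++ f.state u v :=
  f.map_append u v

/-- A group of tree automorphisms is self-similar if it contains all states of its elements. -/
def IsSelfSimilar (G : Subgroup (TreeAut d)) : Prop :=
  ∀ f ∈ G, ∀ u : List (Fin d), f.state u ∈ G

/-! ### The boundary -/

/-- The boundary of the tree: the `d`-ary Cantor space of infinite words, with the product
topology. -/
abbrev Boundary (d : ℕ) : Type := ℕ → Fin d

/-- The finite word formed by the first `n` letters of an infinite word. -/
def pre (w : Boundary d) (n : ℕ) : List (Fin d) := (List.range n).map w

theorem length_pre (w : Boundary d) (n : ℕ) : (pre w n).length = n := by simp [pre]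

/-- The infinite word `uw`, for a finite word `u` and an infinite word `w`. -/
def concat (u : List (Fin d)) (w : Boundary d) : Boundary d := fun n =>
  if h : n < u.length then u[n] else w (n - u.length)

/-- The action of tree automorphisms on the boundary, through finite prefixes. -/
def TreeAut.onBoundary (f : TreeAut d) (w : Boundary d) : Boundary d := fun n =>
  (f (pre w (n + 1)))[n]'(by simp [f.length_map, length_pre])

theorem pre_succ (w : Boundary d) (n : ℕ) : pre w (n + 1) = pre w n ++ [w n] := by
  simp [pre, List.range_succ]

theorem pre_onBoundary (f : TreeAut d) (w : Boundary d) (n : ℕ) :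
    pre (f.onBoundary w) n = f (pre w n) := by
  induction n with
  | zero => simp [pre, f.map_nil]
  | succ n ih =>
    rw [pre_succ, ih]
    obtain ⟨y, hy⟩ := f.edge (pre w n) (w n)
    have hl : (f (pre w n)).length = n := by simp [f.length_map, length_pre]
    rw [← pre_succ] at hy
    simp [TreeAut.onBoundary, hy, hl]

theorem pre_concat (u : List (Fin d)) (w : Boundary d) (n : ℕ) :
    pre (concat u w) (u.length + n) = u ++ pre w n := by
  apply List.ext_getElem
  · simp [pre]
  · intro i h1 h2
    simp only [pre, concat, List.getElem_map, List.getElem_range, List.getElem_append]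

theorem ext_pre {w w' : Boundary d} (k : ℕ) (h : ∀ n, pre w (k + n) = pre w' (k + n)) :
    w = w' := by
  funext n
  have h1 := h (n + 1)
  have h2 : n < (pre w (k + (n + 1))).length := by rw [length_pre]; omega
  have h3 : (pre w (k + (n + 1)))[n]'h2 = (pre w' (k + (n + 1)))[n]'(h1 ▸ h2) := by
    simp only [h1]
  simpa [pre] using h3

theorem concat_append (u v : List (Fin d)) (w : Boundary d) :
    concat (u ++ v) w = concat u (concat v w) := by
  apply ext_pre (u ++ v).length
  intro n
  rw [pre_concat, List.length_append, add_assoc, pre_concat, pre_concat, List.append_assoc]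

theorem onBoundary_concat (f : TreeAut d) (u : List (Fin d)) (w : Boundary d) :
    f.onBoundary (concat u w) = concat (f u) ((f.state u).onBoundary w) := by
  apply ext_pre u.length
  intro n
  rw [pre_onBoundary, pre_concat, f.state_spec]
  have h := pre_concat (f u) ((f.state u).onBoundary w) n
  rw [f.length_map, pre_onBoundary] at h
  exact h.symm

theorem onBoundary_mul (f g : TreeAut d) (w : Boundary d) :
    (f * g).onBoundary w = f.onBoundary (g.onBoundary w) := by
  apply ext_pre 0
  intro n
  simp only [pre_onBoundary, RelIso.mul_apply]

theorem onBoundary_one (w : Boundary d) : (1 : TreeAut d).onBoundary w = w := by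
  apply ext_pre 0
  intro n
  simp only [pre_onBoundary, RelIso.one_apply]

theorem concat_pre (w : Boundary d) (n : ℕ) : concat (pre w n) (fun i => w (n + i)) = w := by
  funext i
  by_cases h : i < n
  · simp [concat, pre, h]
  · have : n + (i - n) = i := by omega
    simp [concat, pre, h, this]

theorem prefix_of_concat_eq {u v : List (Fin d)} {w z : Boundary d}
    (h : concat u w = concat v z) (hl : u.length ≤ v.length) : u <+: v := by
  have h1 := pre_concat u w (v.length - u.length)
  have h2 := pre_concat v z 0
  rw [Nat.add_sub_cancel' hl, h] at h1
  rw [add_zero, h1] at h2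
  exact ⟨_, by simpa [pre] using h2⟩

/-! ### Complete finite subtrees and almost automorphisms -/

/-- A finite complete rooted subtree: it contains the root, is connected (closed under passing to
the parent), and contains with a child of a vertex all other children of that vertex. -/
structure CompleteTree (d : ℕ) where
  verts : Finset (List (Fin d))
  root_mem : [] ∈ verts
  parent_mem : ∀ (u : List (Fin d)) (x : Fin d), u ++ [x] ∈ verts → u ∈ verts
  sibling_mem : ∀ (u : List (Fin d)) (x y : Fin d), u ++ [x] ∈ verts → u ++ [y] ∈ verts

/-- The leaves of a complete tree: the vertices without children in the tree. -/
def CompleteTree.leaves (T : CompleteTree d) : Set (List (Fin d)) :=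
  {u | u ∈ T.verts ∧ ∀ x : Fin d, u ++ [x] ∉ T.verts}

/-- `h` is the almost automorphism `[T₋, σ(f₁, …, fₙ), T₊]`: it maps `v w` to `σ(v) f_v(w)` for every
leaf `v` of `T₊` and every infinite word `w`. Here the leaves are not numbered, so that `σ` is a
bijection from the leaves of `T₊` to those of `T₋` and `f` is indexed by the leaves of `T₊`. -/
def Represents (h : Boundary d ≃ₜ Boundary d) (Tm Tp : CompleteTree d)
    (σ : Tp.leaves ≃ Tm.leaves) (f : Tp.leaves → TreeAut d) : Prop :=
  ∀ (v : Tp.leaves) (w : Boundary d),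
    h (concat (v : List (Fin d)) w) = concat (σ v : List (Fin d)) ((f v).onBoundary w)

/-- `h` is an almost automorphism all of whose labels can be taken in `G`. -/
def IsAlmostAut (G : Subgroup (TreeAut d)) (h : Boundary d ≃ₜ Boundary d) : Prop :=
  ∃ (Tm Tp : CompleteTree d) (σ : Tp.leaves ≃ Tm.leaves) (f : Tp.leaves → TreeAut d),
    (∀ v, f v ∈ G) ∧ Represents h Tm Tp σ f

/-- Auxiliary: on every cone of level `N`, `h` acts by an element of `G` up to a change of
prefix. -/
def IsLocal (G : Subgroup (TreeAut d)) (h : Boundary d ≃ₜ Boundary d) (N : ℕ) : Prop :=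
  ∀ u : List (Fin d), u.length = N → ∃ v, ∃ g ∈ G, ∀ w,
    h (concat u w) = concat v (g.onBoundary w)

theorem CompleteTree.mem_of_prefix (T : CompleteTree d) {u v : List (Fin d)} (h : u <+: v)
    (hv : v ∈ T.verts) : u ∈ T.verts := by
  obtain ⟨t, rfl⟩ := h
  induction t using List.reverseRecOn with
  | nil => simpa using hv
  | append_singleton t x ih =>
    rw [← List.append_assoc] at hv
    exact ih (T.parent_mem _ _ hv)

theorem CompleteTree.exists_leaf_prefix (T : CompleteTree d) (u : List (Fin d))
    (hu : u ∉ T.verts) : ∃ v ∈ T.leaves, v <+: u := by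
  induction u using List.reverseRecOn with
  | nil => exact absurd T.root_mem hu
  | append_singleton u x ih =>
    by_cases h : u ∈ T.verts
    · exact ⟨u, ⟨h, fun y hy => hu (T.sibling_mem u y x hy)⟩, List.prefix_append _ _⟩
    · obtain ⟨v, hv, hp⟩ := ih h
      exact ⟨v, hv, hp.trans (List.prefix_append _ _)⟩

theorem IsAlmostAut.exists_isLocal {G : Subgroup (TreeAut d)} (hG : IsSelfSimilar G)
    {h : Boundary d ≃ₜ Boundary d} (H : IsAlmostAut G h) : ∃ N, IsLocal G h N := by
  obtain ⟨Tm, Tp, σ, f, hf, hr⟩ := H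
  refine ⟨Tp.verts.sup List.length + 1, fun u hu => ?_⟩
  have hu' : u ∉ Tp.verts := fun hm => by
    have := Finset.le_sup (f := List.length) hm
    omega
  obtain ⟨v, hv, t, rfl⟩ := Tp.exists_leaf_prefix u hu'
  refine ⟨σ ⟨v, hv⟩ ++ f ⟨v, hv⟩ t, (f ⟨v, hv⟩).state t, hG _ (hf _) _, fun w => ?_⟩
  rw [concat_append, hr ⟨v, hv⟩, onBoundary_concat, concat_append]

theorem IsLocal.isAlmostAut {G : Subgroup (TreeAut d)} {h : Boundary d ≃ₜ Boundary d} {N : ℕ}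
    (H : IsLocal G h N) : IsAlmostAut G h := by
  classical
  let T0 : CompleteTree d :=
    { verts := {[]}
      root_mem := by simp
      parent_mem := by simp
      sibling_mem := by simp }
  rcases Nat.eq_zero_or_pos d with rfl | hd
  · exact ⟨T0, T0, Equiv.refl _, fun _ => 1, fun _ => G.one_mem, fun _ w => (w 0).elim0⟩
  let z : Boundary d := fun _ => ⟨0, hd⟩
  choose V g hg hV using H
  let V' : (Fin N → Fin d) → List (Fin d) := fun a => V (List.ofFn a) (by simp)
  let g' : (Fin N → Fin d) → TreeAut d := fun a => g (List.ofFn a) (by simp)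
  have hV' : ∀ a w, h (concat (List.ofFn a) w) = concat (V' a) ((g' a).onBoundary w) :=
    fun a w => hV _ _ w
  have hV'' : ∀ a w, h (concat (List.ofFn a) ((g' a)⁻¹.onBoundary w)) = concat (V' a) w := by
    intro a w
    rw [hV', ← onBoundary_mul, mul_inv_cancel, onBoundary_one]
  have hword : ∀ u : List (Fin d), u.length = N → ∃ a : Fin N → Fin d, List.ofFn a = u := by
    rintro u rfl
    exact ⟨u.get, List.ofFn_get u⟩
  have cover : ∀ w, ∃ a w', w = concat (V' a) w' := by
    intro w
    obtain ⟨a, ha⟩ := hword (pre (h.symm w) N) (length_pre _ _)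
    refine ⟨a, (g' a).onBoundary (fun i => (h.symm w) (N + i)), ?_⟩
    rw [← hV', ha, concat_pre, h.apply_symm_apply]
  have disj : ∀ a b, V' a <+: V' b → a = b := by
    rintro a b ⟨t, ht⟩
    have h1 := hV'' b z
    rw [← ht, concat_append, ← hV'' a] at h1
    have h2 := h.injective h1
    have h3 := (prefix_of_concat_eq h2 (by simp)).eq_of_length (by simp)
    exact (List.ofFn_injective h3).symm
  let Tm : CompleteTree d :=
    { verts := Finset.univ.biUnion fun a : Fin N → Fin d => (V' a).inits.toFinset
      root_mem := by
        obtain ⟨a, -, -⟩ := cover z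
        simp only [Finset.mem_biUnion, Finset.mem_univ, true_and, List.mem_toFinset,
          List.mem_inits]
        exact ⟨a, List.nil_prefix⟩
      parent_mem := by
        intro u x
        simp only [Finset.mem_biUnion, Finset.mem_univ, true_and, List.mem_toFinset,
          List.mem_inits]
        rintro ⟨a, ha⟩
        exact ⟨a, (List.prefix_append _ _).trans ha⟩
      sibling_mem := by
        intro u x y
        simp only [Finset.mem_biUnion, Finset.mem_univ, true_and, List.mem_toFinset,
          List.mem_inits]
        rintro ⟨a, ha⟩
        obtain ⟨b, w, hb⟩ := cover (concat (u ++ [y]) z)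
        refine ⟨b, ?_⟩
        rcases le_total (u ++ [y]).length (V' b).length with hl | hl
        · exact prefix_of_concat_eq hb hl
        · have h1 := prefix_of_concat_eq hb.symm hl
          rcases List.prefix_concat_iff.1 h1 with h2 | h2
          · rw [h2]
          · have h3 := disj b a (h2.trans ((List.prefix_append _ _).trans ha))
            subst h3
            have h4 := h2.length_le
            have h5 := ha.length_le
            simp at h5
            omega }
  have mem_Tm : ∀ u, u ∈ Tm.verts ↔ ∃ a, u <+: V' a := by
    intro u
    simp only [Tm, Finset.mem_biUnion, Finset.mem_univ, true_and, List.mem_toFinset,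
      List.mem_inits]
  have leaf_Tm : ∀ u, u ∈ Tm.leaves ↔ ∃ a, u = V' a := by
    intro u
    constructor
    · rintro ⟨h1, h2⟩
      obtain ⟨a, t, ht⟩ := (mem_Tm u).1 h1
      refine ⟨a, ?_⟩
      cases t with
      | nil => simpa using ht
      | cons x t => exact absurd ((mem_Tm _).2 ⟨a, t, by simpa using ht⟩) (h2 x)
    · rintro ⟨a, rfl⟩
      refine ⟨(mem_Tm _).2 ⟨a, List.prefix_rfl⟩, fun x hx => ?_⟩
      obtain ⟨b, hb⟩ := (mem_Tm _).1 hx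
      have h3 := disj a b ((List.prefix_append _ _).trans hb)
      subst h3
      have h5 := hb.length_le
      simp at h5
  let Tp : CompleteTree d :=
    { verts := (Finset.range (N + 1)).biUnion fun n =>
        Finset.univ.image fun a : Fin n → Fin d => List.ofFn a
      root_mem := by
        simp only [Finset.mem_biUnion, Finset.mem_range, Finset.mem_image, Finset.mem_univ,
          true_and]
        exact ⟨0, by omega, Fin.elim0, by simp⟩
      parent_mem := by
        intro u x
        simp only [Finset.mem_biUnion, Finset.mem_range, Finset.mem_image, Finset.mem_univ,
          true_and]
        rintro ⟨n, hn, a, ha⟩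
        have hl := congrArg List.length ha
        simp at hl
        exact ⟨u.length, by omega, u.get, List.ofFn_get u⟩
      sibling_mem := by
        intro u x y
        simp only [Finset.mem_biUnion, Finset.mem_range, Finset.mem_image, Finset.mem_univ,
          true_and]
        rintro ⟨n, hn, a, ha⟩
        have hl := congrArg List.length ha
        simp at hl
        exact ⟨(u ++ [y]).length, by simp; omega, (u ++ [y]).get, List.ofFn_get _⟩ }
  have mem_Tp : ∀ u, u ∈ Tp.verts ↔ u.length ≤ N := by
    intro u
    simp only [Tp, Finset.mem_biUnion, Finset.mem_range, Finset.mem_image, Finset.mem_univ,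
      true_and]
    constructor
    · rintro ⟨n, hn, a, rfl⟩
      simp
      omega
    · intro hu
      exact ⟨u.length, by omega, u.get, List.ofFn_get u⟩
  have leaf_Tp : ∀ u, u ∈ Tp.leaves ↔ u.length = N := by
    intro u
    constructor
    · rintro ⟨h1, h2⟩
      have h3 := h2 ⟨0, hd⟩
      rw [mem_Tp] at h1 h3
      simp at h3
      omega
    · intro hu
      refine ⟨(mem_Tp u).2 hu.le, fun x hx => ?_⟩
      have := (mem_Tp _).1 hx
      simp at this
      omega
  have hbij : Function.Bijective (fun u : Tp.leaves =>
      (⟨V u.1 ((leaf_Tp _).1 u.2), (leaf_Tm _).2 (by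
        obtain ⟨a, ha⟩ := hword u.1 ((leaf_Tp _).1 u.2)
        exact ⟨a, by simp only [V', ha]⟩)⟩ : Tm.leaves)) := by
    constructor
    · rintro ⟨u, hu⟩ ⟨v, hv⟩ huv
      obtain ⟨a, rfl⟩ := hword u ((leaf_Tp _).1 hu)
      obtain ⟨b, rfl⟩ := hword v ((leaf_Tp _).1 hv)
      have h1 : V' a = V' b := congrArg Subtype.val huv
      have h2 := disj a b (by rw [h1])
      subst h2
      rfl
    · rintro ⟨v, hv⟩
      obtain ⟨a, rfl⟩ := (leaf_Tm v).1 hv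
      exact ⟨⟨List.ofFn a, (leaf_Tp _).2 (by simp)⟩, rfl⟩
  exact ⟨Tm, Tp, Equiv.ofBijective _ hbij, fun u => g u.1 ((leaf_Tp _).1 u.2),
    fun u => hg _ _, fun u w => hV _ _ w⟩

theorem isAlmostAut_one (G : Subgroup (TreeAut d)) : IsAlmostAut G 1 := by
  refine IsLocal.isAlmostAut (N := 0) fun u _ => ⟨u, 1, G.one_mem, fun w => ?_⟩
  rw [onBoundary_one]
  rfl

theorem IsAlmostAut.mul {G : Subgroup (TreeAut d)} (hG : IsSelfSimilar G)
    {h k : Boundary d ≃ₜ Boundary d} (hh : IsAlmostAut G h) (hk : IsAlmostAut G k) :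
    IsAlmostAut G (h * k) := by
  obtain ⟨N, hN⟩ := hh.exists_isLocal hG
  obtain ⟨M, hM⟩ := hk.exists_isLocal hG
  refine IsLocal.isAlmostAut (N := M + N) fun u hu => ?_
  obtain ⟨v, g, hg, hv⟩ := hM (u.take M) (by simp [hu])
  have hlen : (v ++ g (u.drop M)).length = v.length + N := by simp [g.length_map, hu]
  obtain ⟨v', g', hg', hv'⟩ := hN ((v ++ g (u.drop M)).take N) (by simp [hlen])
  refine ⟨v' ++ g' ((v ++ g (u.drop M)).drop N),
    g'.state ((v ++ g (u.drop M)).drop N) * g.state (u.drop M),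
    G.mul_mem (hG _ hg' _) (hG _ hg _), fun w => ?_⟩
  have h1 : concat u w = concat (u.take M) (concat (u.drop M) w) := by
    rw [← concat_append, List.take_append_drop]
  change h (k (concat u w)) = _
  rw [h1, hv, onBoundary_concat, ← concat_append,
    ← List.take_append_drop N (v ++ g (u.drop M)), concat_append, hv', onBoundary_concat,
    ← concat_append, onBoundary_mul, List.take_append_drop]

theorem IsAlmostAut.inv {G : Subgroup (TreeAut d)} (hG : IsSelfSimilar G)
    {h : Boundary d ≃ₜ Boundary d} (hh : IsAlmostAut G h) : IsAlmostAut G h⁻¹ := by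
  rcases isEmpty_or_nonempty (Boundary d) with he | ⟨⟨z⟩⟩
  · have : h⁻¹ = 1 := Homeomorph.ext fun w => he.elim w
    rw [this]
    exact isAlmostAut_one G
  obtain ⟨Tm, Tp, σ, f, hf, hr⟩ := hh
  refine IsLocal.isAlmostAut (N := Tm.verts.sup List.length + 1) fun u hu => ?_
  have hu' : u ∉ Tm.verts := fun hm => by
    have := Finset.le_sup (f := List.length) hm
    omega
  obtain ⟨v, hv, t, rfl⟩ := Tm.exists_leaf_prefix u hu'
  set p := σ.symm ⟨v, hv⟩ with hp
  have hσ : σ p = ⟨v, hv⟩ := by simp [hp]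
  refine ⟨p ++ (f p)⁻¹ t, ((f p)⁻¹).state t, hG _ (G.inv_mem (hf _)) _, fun w => ?_⟩
  rw [concat_append, concat_append, ← onBoundary_concat]
  change h.symm _ = _
  rw [Homeomorph.symm_apply_eq, hr, hσ, ← onBoundary_mul, mul_inv_cancel, onBoundary_one]

/-- The Röver–Nekrashevych group `V_d(G)` of a self-similar group `G`, as a subgroup of the group
of homeomorphisms of the boundary. -/
def roverNekrashevych (G : Subgroup (TreeAut d)) (hG : IsSelfSimilar G) :
    Subgroup (Boundary d ≃ₜ Boundary d) where
  carrier := {h | IsAlmostAut G h}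
  one_mem' := isAlmostAut_one G
  mul_mem' hh hk := hh.mul hG hk
  inv_mem' hh := hh.inv hG

/-! ### Persistent retractions -/

/-- A homomorphism is a retraction if it has a right inverse that is a homomorphism. -/
def IsRetraction {G Q : Type*} [Group G] [Group Q] (r : G →* Q) : Prop :=
  ∃ i : Q →* G, r.comp i = MonoidHom.id Q

/-- `r` takes the same value at an element of `G` and at each of its states. -/
def IsPersistent {G : Subgroup (TreeAut d)} (hG : IsSelfSimilar G) {Q : Type*} [Group Q]
    (r : G →* Q) : Prop :=
  ∀ (g : G) (u : List (Fin d)), r ⟨(g : TreeAut d).state u, hG g g.2 u⟩ = r g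

/-! ### Quasi-retracts -/

/-- A function between sets with distance functions is coarse Lipschitz. -/
def CoarseLipschitz {X Y : Type*} (dX : X → X → ℝ) (dY : Y → Y → ℝ) (f : X → Y) : Prop :=
  ∃ C > 0, ∃ D > 0, ∀ x x' : X, dY (f x) (f x') ≤ C * dX x x' + D

/-- `ρ` is a quasi-retraction. -/
def IsQuasiRetraction {X Y : Type*} (dX : X → X → ℝ) (dY : Y → Y → ℝ) (ρ : X → Y) : Prop :=
  CoarseLipschitz dX dY ρ ∧
    ∃ ι : Y → X, CoarseLipschitz dY dX ι ∧ ∃ E > 0, ∀ y, dY (ρ (ι y)) y ≤ E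

/-- The word length of `g` with respect to `S`: the least length of a word in `S ∪ S⁻¹` that
represents `g`. (It is used only when `S` generates the group.) -/
noncomputable def wordLength {Γ : Type*} [Group Γ] (S : Set Γ) (g : Γ) : ℕ :=
  sInf {n | ∃ l : List Γ, l.length = n ∧ (∀ x ∈ l, x ∈ S ∨ x⁻¹ ∈ S) ∧ l.prod = g}

/-- The word metric with respect to `S`. -/
noncomputable def wordDist {Γ : Type*} [Group Γ] (S : Set Γ) (g h : Γ) : ℝ :=
  wordLength S (g⁻¹ * h)

/-- The group `Q` is a quasi-retract of the group `Γ`: both are finitely generated, and there is a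
quasi-retraction from `Γ` to `Q` for word metrics of finite generating sets. -/
def IsQuasiRetract (Γ Q : Type*) [Group Γ] [Group Q] : Prop :=
  ∃ (S : Set Γ) (T : Set Q), S.Finite ∧ Subgroup.closure S = ⊤ ∧
    T.Finite ∧ Subgroup.closure T = ⊤ ∧
    ∃ ρ : Γ → Q, IsQuasiRetraction (wordDist S) (wordDist T) ρ

end SelfSim

open SelfSim

namespace SelfSim

variable {d : ℕ}

/-! The alphabet is enlarged threefold: `G` acts on words over `Fin 3 × Fin d` through the second
coordinates and fixes the first ones (`lift`). States of lifts are lifts of states (`state_lift`),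
so the image is self-similar and `r` remains persistent on it, while each first-level state now
occurs at three letters.

Finite generation. Over at least two letters, a Röver–Nekrashevych group is generated by swaps of
incomparable cones and copies of `G` on cones (`roverNekrashevych_le`). Given a third letter,
conjugation by short swaps shortens prefixes, so finitely many generators suffice
(`roverNekrashevych_fg`).

Finite abelianization. Swaps are involutions, and the copies of one element on cones other than the
whole boundary all have the same image. An element of `G` on a cone is a permutation of the child
cones times its states on them. If the states come in `m` equal copies, its image is an element
killed by 2 times an `m`-th power (`finite_abelianization`). A finitely generated abelian group made
of such products is finite when `m ≥ 2` (`finite_of_forall_eq_mul_pow`).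

Quasi-retract. By persistence, the value of `r` on the label of `h` near a boundary point does not
depend on the size of the cone used (`HasGerm.unique`). This yields a cocycle `c (h * k) w = c h (k
w) * c k w` with finitely many values for each `h`. Its value at a base point gives a coarse
Lipschitz map to `Q`, with right inverse the embedding of `Q` through a section of `r`
(`isQuasiRetract_of_isPersistent`). -/

/-! ### Cones -/

/-- The cone of infinite words with prefix `u`. -/
def cone (u : List (Fin d)) : Set (Boundary d) := Set.range (concat u)

/-- The infinite word obtained by deleting the first `k` letters. -/
def tail (w : Boundary d) (k : ℕ) : Boundary d := fun i => w (k + i)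

theorem tail_concat (u : List (Fin d)) (w : Boundary d) : tail (concat u w) u.length = w := by
  funext i
  simp [tail, concat]

theorem concat_injective (u : List (Fin d)) : Function.Injective (concat u) := fun w z h => by
  rw [← tail_concat u w, h, tail_concat]

theorem concat_nil (w : Boundary d) : concat [] w = w := by
  funext i
  simp [concat]

theorem concat_mem_cone (u : List (Fin d)) (w : Boundary d) : concat u w ∈ cone u := ⟨w, rfl⟩

theorem mem_cone_iff {u : List (Fin d)} {w : Boundary d} : w ∈ cone u ↔ pre w u.length = u := by
  constructor
  · rintro ⟨z, rfl⟩
    simpa [pre] using pre_concat u z 0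
  · intro h
    exact ⟨_, by simpa only [h] using concat_pre w u.length⟩

theorem isOpen_pre_eq (w : Boundary d) (n : ℕ) : IsOpen {z : Boundary d | pre z n = pre w n} := by
  convert PiNat.isOpen_cylinder (fun _ : ℕ => Fin d) w n using 1
  ext z
  simp [pre, PiNat.cylinder]

theorem isClopen_cone (u : List (Fin d)) : IsClopen (cone u) := by
  constructor
  · rw [← isOpen_compl_iff, isOpen_iff_forall_mem_open]
    intro w hw
    refine ⟨_, fun z hz => ?_, isOpen_pre_eq w u.length, rfl⟩
    simp only [Set.mem_ofPred_eq] at hz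
    rw [Set.mem_compl_iff, mem_cone_iff] at hw ⊢
    rwa [hz]
  · rw [isOpen_iff_forall_mem_open]
    intro w hw
    refine ⟨_, fun z hz => ?_, isOpen_pre_eq w u.length, rfl⟩
    simp only [Set.mem_ofPred_eq] at hz
    rw [mem_cone_iff] at hw ⊢
    rwa [hz]

theorem continuous_tail (k : ℕ) : Continuous fun w : Boundary d => tail w k :=
  continuous_pi fun i => continuous_apply (k + i)

theorem continuous_concat (u : List (Fin d)) : Continuous (concat u) := by
  refine continuous_pi fun i => ?_
  unfold concat
  split_ifs
  · exact continuous_const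
  · exact continuous_apply _

theorem continuous_onBoundary (f : TreeAut d) : Continuous f.onBoundary := by
  refine continuous_pi fun n => IsLocallyConstant.continuous ?_
  rw [IsLocallyConstant.iff_exists_open]
  refine fun w => ⟨_, isOpen_pre_eq w (n + 1), rfl, fun z hz => ?_⟩
  simp only [Set.mem_ofPred_eq] at hz
  simp only [TreeAut.onBoundary, hz]

open Classical in
theorem continuous_ite_cone (u : List (Fin d)) {f g : Boundary d → Boundary d} (hf : Continuous f)
    (hg : Continuous g) : Continuous fun w => if w ∈ cone u then f w else g w := by
  refine Continuous.if (fun w hw => ?_) hf hg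
  simp [(isClopen_cone u).frontier_eq] at hw

/-- Two words are incomparable if neither is a prefix of the other. -/
def Incomp (u v : List (Fin d)) : Prop := ¬ u <+: v ∧ ¬ v <+: u

theorem Incomp.symm {u v : List (Fin d)} (h : Incomp u v) : Incomp v u := ⟨h.2, h.1⟩

theorem Incomp.notMem {u v : List (Fin d)} (h : Incomp u v) (w : Boundary d) :
    concat u w ∉ cone v := by
  rintro ⟨z, hz⟩
  rcases le_total u.length v.length with hl | hl
  · exact h.1 (prefix_of_concat_eq hz.symm hl)
  · exact h.2 (prefix_of_concat_eq hz hl)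

theorem prefix_or_incomp {u v : List (Fin d)} (h : u.length ≤ v.length) : u <+: v ∨ Incomp u v := by
  by_cases h1 : u <+: v
  · exact Or.inl h1
  · refine Or.inr ⟨h1, fun h2 => h1 ?_⟩
    rw [h2.eq_of_length (le_antisymm h2.length_le h)]

/-- A prefix relation would nest the cones, and cones are nonempty because there is a letter. -/
theorem incomp_of_disjoint_cone (hd : 0 < d) {u v : List (Fin d)}
    (h : ∀ w ∈ cone u, w ∉ cone v) : Incomp u v := by
  let z : Boundary d := fun _ => ⟨0, hd⟩
  constructor
  · rintro ⟨t, rfl⟩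
    exact h _ ⟨concat t z, (concat_append u t z).symm⟩ (concat_mem_cone _ _)
  · rintro ⟨t, rfl⟩
    exact h _ (concat_mem_cone _ z) ⟨concat t z, (concat_append v t z).symm⟩

/-! ### Homeomorphisms supported on cones -/

/-- The action of tree automorphisms on the boundary by homeomorphisms. -/
def toHomeo : TreeAut d →* (Boundary d ≃ₜ Boundary d) where
  toFun f :=
    { toFun := f.onBoundary
      invFun := (f⁻¹).onBoundary
      left_inv := fun w => by rw [← onBoundary_mul, inv_mul_cancel, onBoundary_one]
      right_inv := fun w => by rw [← onBoundary_mul, mul_inv_cancel, onBoundary_one]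
      continuous_toFun := continuous_onBoundary f
      continuous_invFun := continuous_onBoundary _ }
  map_one' := Homeomorph.ext onBoundary_one
  map_mul' f g := Homeomorph.ext (onBoundary_mul f g)

theorem toHomeo_apply (f : TreeAut d) (w : Boundary d) : toHomeo f w = f.onBoundary w := rfl

open Classical in
/-- The map `u w ↦ u k(w)` that is the identity outside the cone of `u`. -/
noncomputable def coneFun (u : List (Fin d)) (k : Boundary d → Boundary d) (w : Boundary d) :
    Boundary d :=
  if w ∈ cone u then concat u (k (tail w u.length)) else w

theorem coneFun_concat (u : List (Fin d)) (k : Boundary d → Boundary d) (w : Boundary d) :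
    coneFun u k (concat u w) = concat u (k w) := by
  rw [coneFun, if_pos (concat_mem_cone u w), tail_concat]

theorem coneFun_of_notMem {u : List (Fin d)} (k : Boundary d → Boundary d) {w : Boundary d}
    (hw : w ∉ cone u) : coneFun u k w = w := if_neg hw

theorem coneFun_comp (u : List (Fin d)) (k l : Boundary d → Boundary d) (w : Boundary d) :
    coneFun u k (coneFun u l w) = coneFun u (k ∘ l) w := by
  by_cases hw : w ∈ cone u
  · obtain ⟨z, rfl⟩ := hw
    simp only [coneFun_concat, Function.comp_apply]
  · simp only [coneFun_of_notMem _ hw]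

theorem coneFun_id (u : List (Fin d)) (w : Boundary d) : coneFun u id w = w := by
  by_cases hw : w ∈ cone u
  · obtain ⟨z, rfl⟩ := hw
    simp only [coneFun_concat, id]
  · simp only [coneFun_of_notMem _ hw]

theorem continuous_coneFun (u : List (Fin d)) {k : Boundary d → Boundary d} (hk : Continuous k) :
    Continuous (coneFun u k) :=
  continuous_ite_cone u ((continuous_concat u).comp (hk.comp (continuous_tail _))) continuous_id

/-- The homeomorphism `u w ↦ u k(w)` supported on the cone of `u`. -/
noncomputable def coneMap (u : List (Fin d)) :
    (Boundary d ≃ₜ Boundary d) →* (Boundary d ≃ₜ Boundary d) where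
  toFun k :=
    { toFun := coneFun u k
      invFun := coneFun u k.symm
      left_inv := fun w => by
        rw [coneFun_comp, k.symm_comp_self, coneFun_id]
      right_inv := fun w => by
        rw [coneFun_comp, k.self_comp_symm, coneFun_id]
      continuous_toFun := continuous_coneFun u k.continuous
      continuous_invFun := continuous_coneFun u k.symm.continuous }
  map_one' := Homeomorph.ext fun w => coneFun_id u w
  map_mul' k l := Homeomorph.ext fun w => (coneFun_comp u k l w).symm

theorem coneMap_concat (u : List (Fin d)) (k : Boundary d ≃ₜ Boundary d) (w : Boundary d) :
    coneMap u k (concat u w) = concat u (k w) := coneFun_concat u k w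

theorem coneMap_of_notMem {u : List (Fin d)} (k : Boundary d ≃ₜ Boundary d) {w : Boundary d}
    (hw : w ∉ cone u) : coneMap u k w = w := if_neg hw

/-! ### Exchanging two cones -/

open Classical in
/-- The map that exchanges the prefixes `u` and `v`. -/
noncomputable def swapFun (u v : List (Fin d)) (w : Boundary d) : Boundary d :=
  if w ∈ cone u then concat v (tail w u.length)
  else if w ∈ cone v then concat u (tail w v.length) else w

theorem swapFun_left (u v : List (Fin d)) (w : Boundary d) :
    swapFun u v (concat u w) = concat v w := by
  rw [swapFun, if_pos (concat_mem_cone u w), tail_concat]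

theorem swapFun_right {u v : List (Fin d)} (h : Incomp u v) (w : Boundary d) :
    swapFun u v (concat v w) = concat u w := by
  rw [swapFun, if_neg (h.symm.notMem w), if_pos (concat_mem_cone v w), tail_concat]

theorem swapFun_of_notMem {u v : List (Fin d)} {w : Boundary d} (hu : w ∉ cone u)
    (hv : w ∉ cone v) : swapFun u v w = w := by
  rw [swapFun, if_neg hu, if_neg hv]

theorem swapFun_swapFun {u v : List (Fin d)} (h : Incomp u v) (w : Boundary d) :
    swapFun u v (swapFun u v w) = w := by
  by_cases hu : w ∈ cone u
  · obtain ⟨z, rfl⟩ := hu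
    rw [swapFun_left, swapFun_right h]
  · by_cases hv : w ∈ cone v
    · obtain ⟨z, rfl⟩ := hv
      rw [swapFun_right h, swapFun_left]
    · rw [swapFun_of_notMem hu hv, swapFun_of_notMem hu hv]

theorem continuous_swapFun (u v : List (Fin d)) : Continuous (swapFun u v) :=
  continuous_ite_cone u ((continuous_concat v).comp (continuous_tail _))
    (continuous_ite_cone v ((continuous_concat u).comp (continuous_tail _)) continuous_id)

/-- The homeomorphism that exchanges the incomparable prefixes `u` and `v`. -/
noncomputable def swap (u v : List (Fin d)) (h : Incomp u v) : Boundary d ≃ₜ Boundary d where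
  toFun := swapFun u v
  invFun := swapFun u v
  left_inv := swapFun_swapFun h
  right_inv := swapFun_swapFun h
  continuous_toFun := continuous_swapFun u v
  continuous_invFun := continuous_swapFun u v

section swap

variable {u v : List (Fin d)} (h : Incomp u v)

theorem swap_left (w : Boundary d) : swap u v h (concat u w) = concat v w := swapFun_left u v w

theorem swap_right (w : Boundary d) : swap u v h (concat v w) = concat u w := swapFun_right h w

theorem swap_of_notMem {w : Boundary d} (hu : w ∉ cone u) (hv : w ∉ cone v) :
    swap u v h w = w := swapFun_of_notMem hu hv

theorem swap_mul_self : swap u v h * swap u v h = 1 := Homeomorph.ext (swapFun_swapFun h)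

theorem swap_comm : swap u v h = swap v u h.symm := by
  ext1 w
  by_cases hu : w ∈ cone u
  · obtain ⟨z, rfl⟩ := hu
    rw [swap_left, swap_right]
  · by_cases hv : w ∈ cone v
    · obtain ⟨z, rfl⟩ := hv
      rw [swap_left, swap_right]
    · rw [swap_of_notMem h hu hv, swap_of_notMem _ hv hu]

end swap

theorem apply_notMem_cone {φ : Boundary d ≃ₜ Boundary d} {u u' : List (Fin d)}
    (hφ : ∀ w, φ (concat u w) = concat u' w) {w : Boundary d} (hw : w ∉ cone u) :
    φ w ∉ cone u' := by
  rintro ⟨z, hz⟩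
  rw [← hφ] at hz
  exact hw ⟨z, φ.injective hz⟩

/-- Only the behaviour of `φ` on the cone of `u` matters. With `φ` a swap, this serves both to
shorten prefixes and to identify images in the abelianization. -/
theorem conj_coneMap {φ : Boundary d ≃ₜ Boundary d} {u u' : List (Fin d)}
    (hφ : ∀ w, φ (concat u w) = concat u' w) (k : Boundary d ≃ₜ Boundary d) :
    φ * coneMap u k * φ⁻¹ = coneMap u' k := by
  rw [mul_inv_eq_iff_eq_mul]
  ext1 w
  change φ (coneMap u k w) = coneMap u' k (φ w)
  by_cases hu : w ∈ cone u
  · obtain ⟨z, rfl⟩ := hu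
    rw [coneMap_concat, hφ, hφ, coneMap_concat]
  · rw [coneMap_of_notMem _ hu, coneMap_of_notMem _ (apply_notMem_cone hφ hu)]

theorem conj_swap {φ : Boundary d ≃ₜ Boundary d} {u u' v v' : List (Fin d)}
    (hφ : ∀ w, φ (concat u w) = concat u' w) (hφ' : ∀ w, φ (concat v w) = concat v' w)
    (h : Incomp u v) (h' : Incomp u' v') : φ * swap u v h * φ⁻¹ = swap u' v' h' := by
  rw [mul_inv_eq_iff_eq_mul]
  ext1 w
  change φ (swap u v h w) = swap u' v' h' (φ w)
  by_cases hu : w ∈ cone u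
  · obtain ⟨z, rfl⟩ := hu
    rw [swap_left, hφ, hφ', swap_left]
  · by_cases hv : w ∈ cone v
    · obtain ⟨z, rfl⟩ := hv
      rw [swap_right, hφ, hφ', swap_right]
    · rw [swap_of_notMem h hu hv,
        swap_of_notMem h' (apply_notMem_cone hφ hu) (apply_notMem_cone hφ' hv)]

theorem incomp_of_conj (hd : 0 < d) {φ : Boundary d ≃ₜ Boundary d} {u u' v v' : List (Fin d)}
    (hφ : ∀ w, φ (concat u w) = concat u' w) (hφ' : ∀ w, φ (concat v w) = concat v' w)
    (h : Incomp u v) : Incomp u' v' := by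
  refine incomp_of_disjoint_cone hd ?_
  rintro _ ⟨z, rfl⟩
  rw [← hφ]
  exact apply_notMem_cone hφ' (h.notMem z)

/-! ### Membership in the Röver–Nekrashevych group -/

variable {G : Subgroup (TreeAut d)}

theorem swap_mem (hG : IsSelfSimilar G) {u v : List (Fin d)} (h : Incomp u v) :
    swap u v h ∈ roverNekrashevych G hG := by
  -- At this level every word extends `u`, extends `v`, or is incomparable with both.
  refine IsLocal.isAlmostAut (N := max u.length v.length) fun t ht => ?_
  rcases prefix_or_incomp (u := u) (v := t) (by omega) with ⟨s, rfl⟩ | hu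
  · refine ⟨v ++ s, 1, G.one_mem, fun w => ?_⟩
    rw [concat_append, swap_left, onBoundary_one, concat_append]
  · rcases prefix_or_incomp (u := v) (v := t) (by omega) with ⟨s, rfl⟩ | hv
    · refine ⟨u ++ s, 1, G.one_mem, fun w => ?_⟩
      rw [concat_append, swap_right, onBoundary_one, concat_append]
    · refine ⟨t, 1, G.one_mem, fun w => ?_⟩
      rw [swap_of_notMem h (hu.symm.notMem w) (hv.symm.notMem w), onBoundary_one]

theorem coneMap_mem (hG : IsSelfSimilar G) (u : List (Fin d)) {g : TreeAut d} (hg : g ∈ G) :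
    coneMap u (toHomeo g) ∈ roverNekrashevych G hG := by
  refine IsLocal.isAlmostAut (N := u.length) fun t ht => ?_
  rcases prefix_or_incomp (u := u) (v := t) (by omega) with hu | hu
  · have h1 := hu.eq_of_length ht.symm
    subst h1
    exact ⟨u, g, hg, fun w => coneMap_concat _ _ _⟩
  · refine ⟨t, 1, G.one_mem, fun w => ?_⟩
    rw [coneMap_of_notMem _ (hu.symm.notMem w), onBoundary_one]

theorem coneMap_nil (k : Boundary d ≃ₜ Boundary d) : coneMap [] k = k := by
  ext1 w
  have h := coneMap_concat [] k w
  rwa [concat_nil, concat_nil] at h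

/-! ### Products of cone maps and permutations of cones -/

section

variable {H : Subgroup (Boundary d ≃ₜ Boundary d)} {A : Type*} [CommGroup A] (φ : H →* A)
  {ι : Type*} {c : ι → List (Fin d)}

/-- The subgroup `H` and the homomorphism `φ` are kept general so that the same factorization serves
generation (`φ` trivial) and the computation in the abelianization. -/
theorem exists_prod_coneMap (hc : Pairwise fun i j => Incomp (c i) (c j))
    {k : ι → (Boundary d ≃ₜ Boundary d)} (hk : ∀ i, coneMap (c i) (k i) ∈ H) (S : Finset ι) :
    ∃ s : H, (∀ i ∈ S, ∀ w, s.1 (concat (c i) w) = concat (c i) (k i w)) ∧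
      (∀ w, (∀ i ∈ S, w ∉ cone (c i)) → s.1 w = w) ∧ φ s = ∏ i ∈ S, φ ⟨_, hk i⟩ := by
  classical
  induction S using Finset.induction_on with
  | empty => exact ⟨1, by simp, fun w _ => rfl, by simp⟩
  | insert a S ha ih =>
    obtain ⟨s, h1, h2, h3⟩ := ih
    have hne : ∀ i ∈ S, a ≠ i := fun i hi h => ha (h ▸ hi)
    refine ⟨⟨_, hk a⟩ * s, fun i hi w => ?_, fun w hw => ?_, ?_⟩
    · change coneMap (c a) (k a) (s.1 _) = _
      rcases Finset.mem_insert.1 hi with rfl | hi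
      · rw [h2 _ fun j hj => (hc (hne j hj)).notMem w, coneMap_concat]
      · rw [h1 i hi, coneMap_of_notMem _ ((hc (hne i hi)).symm.notMem _)]
    · change coneMap (c a) (k a) (s.1 _) = _
      rw [h2 _ fun j hj => hw j (Finset.mem_insert_of_mem hj),
        coneMap_of_notMem _ (hw a (Finset.mem_insert_self _ _))]
    · rw [map_mul, h3, Finset.prod_insert ha]

/-- A permutation is a product of transpositions, each realized by a swap. Swaps are involutions and
`A` is commutative, so the product is killed by 2 in `A`. -/
theorem exists_perm_cones (hsw : ∀ u v h, swap u v h ∈ H)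
    (hc : Pairwise fun i j => Incomp (c i) (c j)) [Finite ι] (π : Equiv.Perm ι) :
    ∃ s : H, (∀ i w, s.1 (concat (c i) w) = concat (c (π i)) w) ∧
      (∀ w, (∀ i, w ∉ cone (c i)) → s.1 w = w) ∧ φ s ^ 2 = 1 := by
  classical
  induction π using Equiv.Perm.swap_induction_on with
  | one => exact ⟨1, fun i w => rfl, fun w _ => rfl, by simp⟩
  | swap_mul π a b hab ih =>
    obtain ⟨s, h1, h2, h3⟩ := ih
    have hi := hc hab
    refine ⟨⟨_, hsw _ _ hi⟩ * s, fun i w => ?_, fun w hw => ?_, ?_⟩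
    · change swap _ _ hi (s.1 _) = _
      rw [h1, Equiv.Perm.mul_apply]
      by_cases h4 : π i = a
      · rw [h4, Equiv.swap_apply_left, swap_left]
      · by_cases h5 : π i = b
        · rw [h5, Equiv.swap_apply_right, swap_right]
        · rw [Equiv.swap_apply_of_ne_of_ne h4 h5,
            swap_of_notMem hi ((hc h4).notMem w) ((hc h5).notMem w)]
    · change swap _ _ hi (s.1 _) = _
      rw [h2 w hw, swap_of_notMem hi (hw a) (hw b)]
    · have h4 : (⟨_, hsw _ _ hi⟩ : H) ^ 2 = 1 := by
        rw [sq]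
        exact Subtype.ext (swap_mul_self hi)
      rw [map_mul, mul_pow, h3, ← map_pow, h4, map_one, mul_one]

end

/-! ### Splitting a cone map over the child cones -/

theorem incomp_append_singleton (u : List (Fin d)) {x y : Fin d} (h : x ≠ y) :
    Incomp (u ++ [x]) (u ++ [y]) := by
  constructor
  · intro h1
    exact h (by simpa using h1.eq_of_length (by simp))
  · intro h1
    exact h (by simpa using (h1.eq_of_length (by simp)).symm)

theorem concat_head (w : Boundary d) : concat [w 0] (tail w 1) = w := by
  have h : pre w 1 = [w 0] := by simp [pre]
  rw [← h]
  exact concat_pre w 1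

/-- The action of a tree automorphism on its first letter. -/
noncomputable def letterPerm (g : TreeAut d) : Equiv.Perm (Fin d) :=
  Equiv.ofBijective (fun x => (g [x])[0]'(by simp [g.length_map])) <| by
    rw [← Finite.injective_iff_bijective]
    intro x y h
    have key : ∀ z, g [z] = [(g [z])[0]'(by simp [g.length_map])] := fun z =>
      List.ext_getElem (by simp [g.length_map]) fun i h1 h2 => by
        have : i = 0 := by simpa using h2
        subst this
        rfl
    have h1 : g [x] = g [y] := by
      rw [key x, key y]
      simpa using h
    simpa using g.injective h1

theorem apply_singleton (g : TreeAut d) (x : Fin d) : g [x] = [letterPerm g x] :=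
  List.ext_getElem (by simp [g.length_map]) fun i h1 h2 => by
    have : i = 0 := by simpa using h2
    subst this
    rfl

/-- A tree automorphism acting on a cone is the product of its states acting on the children and a
permutation of the children. -/
theorem exists_mul_eq_coneMap {H : Subgroup (Boundary d ≃ₜ Boundary d)} {A : Type*} [CommGroup A]
    (φ : H →* A) (hsw : ∀ u v h, swap u v h ∈ H) (u : List (Fin d)) (g : TreeAut d)
    (hg : ∀ x, coneMap (u ++ [x]) (toHomeo (g.state [x])) ∈ H) :
    ∃ τ s : H, φ τ ^ 2 = 1 ∧ φ s = ∏ x, φ ⟨_, hg x⟩ ∧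
      ((τ * s : H) : Boundary d ≃ₜ Boundary d) = coneMap u (toHomeo g) := by
  have hc : Pairwise fun x y : Fin d => Incomp (u ++ [x]) (u ++ [y]) :=
    fun x y h => incomp_append_singleton u h
  obtain ⟨τ, h1, h2, h3⟩ := exists_perm_cones φ hsw hc (letterPerm g)
  obtain ⟨s, h4, h5, h6⟩ := exists_prod_coneMap φ hc hg Finset.univ
  refine ⟨τ, s, h3, h6, ?_⟩
  ext1 w
  change τ.1 (s.1 w) = _
  by_cases hw : w ∈ cone u
  · obtain ⟨z, rfl⟩ := hw
    rw [← concat_head z, ← concat_append, h4 _ (Finset.mem_univ _), h1, concat_append,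
      concat_append, coneMap_concat, toHomeo_apply, toHomeo_apply, onBoundary_concat,
      apply_singleton]
  · have hw' : ∀ x, w ∉ cone (u ++ [x]) := by
      rintro x ⟨z, rfl⟩
      exact hw ⟨_, (concat_append u [x] z).symm⟩
    rw [h5 w fun x _ => hw' x, h2 w hw', coneMap_of_notMem _ hw]

/-! ### Partitions of the boundary into cones -/

/-- Every infinite word lies in the cone of exactly one word in `S`. -/
def IsPart (S : Finset (List (Fin d))) : Prop := ∀ w, ∃! u, u ∈ S ∧ w ∈ cone u

theorem IsPart.incomp (hd : 0 < d) {S : Finset (List (Fin d))} (hS : IsPart S) {u v : List (Fin d)}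
    (hu : u ∈ S) (hv : v ∈ S) (h : u ≠ v) : Incomp u v :=
  incomp_of_disjoint_cone hd fun w hwu hwv => h ((hS w).unique ⟨hu, hwu⟩ ⟨hv, hwv⟩)

theorem IsPart.image {S : Finset (List (Fin d))} (hS : IsPart S) {h : Boundary d ≃ₜ Boundary d}
    {V : List (Fin d) → List (Fin d)} (hV : ∀ u ∈ S, ∀ w, h (concat u w) = concat (V u) w) :
    IsPart (S.image V) := by
  intro w
  obtain ⟨u, ⟨hu, z, hz⟩, huniq⟩ := hS (h.symm w)
  have hw : w = concat (V u) z := by rw [← hV u hu, hz, h.apply_symm_apply]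
  refine ⟨V u, ⟨Finset.mem_image_of_mem V hu, z, hw.symm⟩, ?_⟩
  rintro v ⟨hv, y, rfl⟩
  obtain ⟨u', hu', rfl⟩ := Finset.mem_image.1 hv
  rw [huniq u' ⟨hu', y, by rw [← hV u' hu', h.symm_apply_apply]⟩]

/-- The parent `p` of a longest word `p x` of `S` works. The word of `S` covering a point below `p
y` is no longer than `p y`, hence a prefix of it. Were it a prefix of `p`, it would be comparable
with `p x`. -/
theorem IsPart.exists_caret (hd : 0 < d) {S : Finset (List (Fin d))} (hS : IsPart S)
    (hnil : [] ∉ S) : ∃ p, ∀ x, p ++ [x] ∈ S := by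
  let z : Boundary d := fun _ => ⟨0, hd⟩
  obtain ⟨u0, ⟨hu0, -⟩, -⟩ := hS z
  obtain ⟨u, hu, hmax⟩ := S.exists_max_image List.length ⟨u0, hu0⟩
  rcases List.eq_nil_or_concat u with rfl | ⟨p, x, rfl⟩
  · exact absurd hu hnil
  refine ⟨p, fun y => ?_⟩
  rw [List.concat_eq_append] at hu hmax
  obtain ⟨v, ⟨hv, a, ha⟩, -⟩ := hS (concat (p ++ [y]) z)
  have hl := hmax v hv
  have h1 := prefix_of_concat_eq ha (by simpa using hl)
  rcases List.prefix_concat_iff.1 h1 with h2 | h2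
  · rwa [← h2]
  · by_cases h3 : v = p ++ [x]
    · subst h3
      have := h2.length_le
      simp at this
    · exact absurd (h2.trans (List.prefix_append p [x])) (hS.incomp hd hv hu h3).1

open Classical in
/-- The result of replacing the children of `p` by `p`. -/
noncomputable def contract (S : Finset (List (Fin d))) (p : List (Fin d)) :
    Finset (List (Fin d)) :=
  insert p (S.filter fun u => ∀ x, u ≠ p ++ [x])

theorem mem_contract {S : Finset (List (Fin d))} {p u : List (Fin d)} :
    u ∈ contract S p ↔ u = p ∨ u ∈ S ∧ ∀ x, u ≠ p ++ [x] := by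
  simp [contract]

theorem IsPart.contract {S : Finset (List (Fin d))} (hS : IsPart S) {p : List (Fin d)}
    (hp : ∀ x, p ++ [x] ∈ S) : IsPart (contract S p) := by
  intro w
  by_cases hw : w ∈ cone p
  · refine ⟨p, ⟨mem_contract.2 (Or.inl rfl), hw⟩, ?_⟩
    rintro v ⟨hv, hwv⟩
    rcases mem_contract.1 hv with rfl | ⟨hv, hv'⟩
    · rfl
    · obtain ⟨z, rfl⟩ := hw
      rw [← concat_head z, ← concat_append] at hwv
      exact absurd ((hS _).unique ⟨hv, hwv⟩ ⟨hp _, concat_mem_cone _ _⟩) (hv' _)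
  · obtain ⟨u, ⟨hu, hwu⟩, huniq⟩ := hS w
    refine ⟨u, ⟨mem_contract.2 (Or.inr ⟨hu, ?_⟩), hwu⟩, ?_⟩
    · rintro x rfl
      obtain ⟨z, rfl⟩ := hwu
      exact hw ⟨_, (concat_append p [x] z).symm⟩
    · rintro v ⟨hv, hwv⟩
      rcases mem_contract.1 hv with rfl | ⟨hv, -⟩
      · exact absurd hwv hw
      · exact huniq v ⟨hv, hwv⟩

theorem card_contract_lt (hd : 2 ≤ d) {S : Finset (List (Fin d))} {p : List (Fin d)}
    (hp : ∀ x, p ++ [x] ∈ S) : (contract S p).card < S.card := by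
  classical
  have h1 : (S.filter fun u => ¬ ∀ x, u ≠ p ++ [x]) = Finset.univ.image fun x => p ++ [x] := by
    ext u
    simp only [Finset.mem_filter, Finset.mem_image, Finset.mem_univ, true_and, not_forall, not_not]
    constructor
    · rintro ⟨-, x, hx⟩
      exact ⟨x, hx.symm⟩
    · rintro ⟨x, rfl⟩
      exact ⟨hp x, x, rfl⟩
  have h2 := Finset.card_filter_add_card_filter_not (s := S) (fun u => ∀ x, u ≠ p ++ [x])
  rw [h1, Finset.card_image_of_injective _ fun x y h => by simpa using h, Finset.card_univ,
    Fintype.card_fin] at h2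
  have h3 := Finset.card_insert_le p (S.filter fun u => ∀ x, u ≠ p ++ [x])
  have h4 := h3.trans_lt (show _ < S.card by omega)
  rw [contract]
  convert h4

/-! ### Generation by swaps and cone maps -/

theorem exists_perm_extending {α β : Type*} [Finite β] {a b : α → β} (ha : Function.Injective a)
    (hb : Function.Injective b) : ∃ π : Equiv.Perm β, ∀ x, π (a x) = b x := by
  classical
  let e : {x // x ∈ Set.range a} ≃ {x // x ∈ Set.range b} :=
    (Equiv.ofInjective a ha).symm.trans (Equiv.ofInjective b hb)
  refine ⟨e.extendSubtype, fun x => ?_⟩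
  have h : (⟨a x, x, rfl⟩ : {x // x ∈ Set.range a}) = Equiv.ofInjective a ha x := rfl
  rw [e.extendSubtype_apply_of_mem _ ⟨x, rfl⟩, h]
  simp [e]

/-- A homeomorphism that changes prefixes on a partition is a product of swaps. -/
theorem mem_of_changes_prefixes (hd : 2 ≤ d) {H : Subgroup (Boundary d ≃ₜ Boundary d)}
    (hsw : ∀ u v h, swap u v h ∈ H) {S : Finset (List (Fin d))} (hS : IsPart S)
    {h : Boundary d ≃ₜ Boundary d} {V : List (Fin d) → List (Fin d)}
    (hV : ∀ u ∈ S, ∀ w, h (concat u w) = concat (V u) w) : h ∈ H := by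
  classical
  have hd0 : 0 < d := by omega
  induction hk : S.card using Nat.strong_induction_on generalizing S h V with
  | _ k ih =>
  subst hk
  by_cases hnil : [] ∈ S
  -- A nonempty new prefix would contradict surjectivity of `h`.
  · have h1 : V [] = [] := by
      by_contra hne
      obtain ⟨x, t, hx⟩ := List.exists_cons_of_ne_nil hne
      obtain ⟨y, hy⟩ : ∃ y : Fin d, y ≠ x := by
        have : Nontrivial (Fin d) := Fin.nontrivial_iff_two_le.2 hd
        exact exists_ne x
      have h2 := hV [] hnil (h.symm fun _ => y)
      rw [concat_nil, h.apply_symm_apply, hx] at h2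
      have h3 := congrFun h2 0
      simp [concat] at h3
      exact hy h3
    have h2 : h = 1 := by
      ext1 w
      have h3 := hV [] hnil w
      rwa [h1, concat_nil] at h3
    rw [h2]
    exact H.one_mem
  · obtain ⟨p, hp⟩ := hS.exists_caret hd0 hnil
    have hS' := hS.image hV
    have hVinj : ∀ u ∈ S, ∀ v ∈ S, V u = V v → u = v := by
      intro u hu v hv huv
      by_contra hne
      have h1 : h (concat u fun _ => ⟨0, hd0⟩) = h (concat v fun _ => ⟨0, hd0⟩) := by
        rw [hV u hu, hV v hv, huv]
      exact (hS.incomp hd0 hu hv hne).notMem _ ⟨_, (h.injective h1).symm⟩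
    have hnil' : [] ∉ S.image V := by
      intro h1
      have h2 : ∀ x, V (p ++ [x]) = [] := fun x => by
        by_contra h3
        exact (hS'.incomp hd0 h1 (Finset.mem_image_of_mem V (hp x)) (Ne.symm h3)).1
          List.nil_prefix
      have h3 := hVinj _ (hp ⟨0, hd0⟩) _ (hp ⟨1, hd⟩) ((h2 _).trans (h2 _).symm)
      simp at h3
    obtain ⟨q, hq⟩ := hS'.exists_caret hd0 hnil'
    -- Both the partition and its image contain a full set of siblings, below `p` and `q`. Permuting
    -- the image cones so that `p x` goes to `q x` for each letter `x` makes the map replace `p`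
    -- itself by `q`, and the siblings below `p` can be merged into a smaller partition.
    obtain ⟨π, hπ⟩ := exists_perm_extending
      (a := fun x => (⟨V (p ++ [x]), Finset.mem_image_of_mem V (hp x)⟩ : S.image V))
      (b := fun x => ⟨q ++ [x], hq x⟩)
      (fun x y hxy => by simpa using hVinj _ (hp x) _ (hp y) (congrArg Subtype.val hxy))
      (fun x y hxy => by simpa using congrArg Subtype.val hxy)
    -- Only the element is needed here, so the homomorphism is trivial.
    obtain ⟨s, hs, -, -⟩ := exists_perm_cones (1 : H →* Multiplicative ℤ) hsw
      (c := fun u : S.image V => u.1)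
      (fun u v huv => hS'.incomp hd0 u.2 v.2 fun h1 => huv (Subtype.ext h1)) π
    have hsh : s.1 * h ∈ H := by
      refine ih _ (card_contract_lt hd hp) (hS.contract hp) (V := fun u =>
        if u = p then q else if hu : u ∈ S then π ⟨V u, Finset.mem_image_of_mem V hu⟩ else u)
        (fun u hu w => ?_) rfl
      change s.1 (h _) = _
      by_cases hup : u = p
      · subst hup
        rw [if_pos rfl, ← concat_head w, ← concat_append, hV _ (hp _)]
        have h1 := hs ⟨V (u ++ [w 0]), Finset.mem_image_of_mem V (hp _)⟩ (tail w 1)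
        rw [hπ] at h1
        rw [h1, concat_append]
      · obtain ⟨hu, -⟩ := (mem_contract.1 hu).resolve_left hup
        rw [if_neg hup, dif_pos hu, hV u hu]
        exact hs ⟨V u, Finset.mem_image_of_mem V hu⟩ w
    exact (H.mul_mem_cancel_left s.2).1 hsh

theorem isPart_words (d N : ℕ) :
    IsPart (Finset.univ.image fun a : Fin N → Fin d => List.ofFn a) := by
  intro w
  refine ⟨pre w N, ⟨?_, ⟨_, concat_pre w N⟩⟩, ?_⟩
  · refine Finset.mem_image.2 ⟨fun i => w i, Finset.mem_univ _, ?_⟩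
    exact List.ext_getElem (by simp [pre]) fun i h1 h2 => by simp [pre]
  · rintro v ⟨hv, hw⟩
    obtain ⟨a, -, rfl⟩ := Finset.mem_image.1 hv
    rw [mem_cone_iff, List.length_ofFn] at hw
    exact hw.symm

/-- The Röver–Nekrashevych group is generated by swaps and by elements of `G` acting on cones. -/
theorem roverNekrashevych_le (hd : 2 ≤ d) {G : Subgroup (TreeAut d)} (hG : IsSelfSimilar G)
    {H : Subgroup (Boundary d ≃ₜ Boundary d)} (hsw : ∀ u v h, swap u v h ∈ H)
    (hcone : ∀ u, ∀ g ∈ G, coneMap u (toHomeo g) ∈ H) : roverNekrashevych G hG ≤ H := by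
  classical
  intro h hh
  obtain ⟨N, hN⟩ := IsAlmostAut.exists_isLocal hG hh
  -- Dummy values at words of other lengths make the prefixes and labels functions on all words.
  have hN' : ∀ u : List (Fin d), ∃ v g, g ∈ G ∧ (u.length = N → ∀ w,
      h (concat u w) = concat v (g.onBoundary w)) := by
    intro u
    by_cases hu : u.length = N
    · obtain ⟨v, g, hg, hv⟩ := hN u hu
      exact ⟨v, g, hg, fun _ => hv⟩
    · exact ⟨u, 1, G.one_mem, fun h => absurd h hu⟩
  choose V g hg hV using hN'
  set S := Finset.univ.image fun a : Fin N → Fin d => List.ofFn a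
  have hS : IsPart S := isPart_words d N
  have hl : ∀ u ∈ S, u.length = N := by
    intro u hu
    obtain ⟨a, -, rfl⟩ := Finset.mem_image.1 hu
    simp
  obtain ⟨s, hs, -, -⟩ := exists_prod_coneMap (1 : H →* Multiplicative ℤ)
    (c := fun u : S => u.1)
    (fun u v huv => hS.incomp (by omega) u.2 v.2 fun h1 => huv (Subtype.ext h1))
    (k := fun u => toHomeo (g u.1)) (fun u => hcone _ _ (hg _)) Finset.univ
  -- Once the labels on the level-`N` cones are divided out, only a change of prefixes remains.
  have h1 : h * (s.1)⁻¹ ∈ H := by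
    refine mem_of_changes_prefixes hd hsw hS (V := V) fun u hu w => ?_
    have h2 := hs ⟨u, hu⟩ (Finset.mem_univ _) ((toHomeo (g u)).symm w)
    rw [Homeomorph.apply_symm_apply] at h2
    change h (s.1.symm _) = _
    rw [← h2, Homeomorph.symm_apply_apply, hV u (hl u hu), ← toHomeo_apply,
      Homeomorph.apply_symm_apply]
  exact (H.mul_mem_cancel_right (H.inv_mem s.2)).1 h1

/-! ### Finite generation -/

theorem exists_ne_ne (hd : 3 ≤ d) (x y : Fin d) : ∃ z, z ≠ x ∧ z ≠ y := by
  have h := Finset.card_le_two (a := x) (b := y)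
  obtain ⟨z, hz⟩ : ∃ z, z ∉ ({x, y} : Finset (Fin d)) := by
    by_contra! h1
    have h2 := Finset.card_le_card (fun z _ => h1 z : Finset.univ ⊆ ({x, y} : Finset (Fin d)))
    rw [Finset.card_univ, Fintype.card_fin] at h2
    omega
  exact ⟨z, by simpa using hz⟩

theorem incomp_cons {x y : Fin d} (h : x ≠ y) (u v : List (Fin d)) : Incomp (x :: u) (y :: v) :=
  ⟨fun h1 => h (List.cons_prefix_cons.1 h1).1, fun h1 => h (List.cons_prefix_cons.1 h1).1.symm⟩

theorem swap_shorten {x y : Fin d} (x' : Fin d) (h : x ≠ y) (u : List (Fin d)) (w : Boundary d) :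
    swap [x, x'] [y] (incomp_cons h _ _) (concat (x :: x' :: u) w) = concat (y :: u) w := by
  have h1 : ∀ (a b : List (Fin d)), concat (a ++ b) w = concat a (concat b w) :=
    fun a b => concat_append a b w
  have h2 := h1 [x, x'] u
  have h3 := h1 [y] u
  simp only [List.cons_append, List.nil_append] at h2 h3
  rw [h2, h3, swap_left]

/-- A prefix longer than 2 begins with some `x x'`. Conjugating by the short swap of `x x'` with a
third letter `z` shortens it by one. The other prefix does not grow, because `z` also differs from
its first letter. Thus the total length drops. -/
theorem swap_mem_of_short (hd : 3 ≤ d) {H : Subgroup (Boundary d ≃ₜ Boundary d)}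
    (hH : ∀ u v h, u.length ≤ 2 → v.length ≤ 2 → swap u v h ∈ H) (u v : List (Fin d))
    (h : Incomp u v) : swap u v h ∈ H := by
  induction hk : u.length + v.length using Nat.strong_induction_on generalizing u v with
  | _ k ih =>
  subst hk
  by_cases hshort : u.length ≤ 2 ∧ v.length ≤ 2
  · exact hH u v h hshort.1 hshort.2
  wlog hu : 2 < u.length generalizing u v with hw
  · rw [swap_comm]
    exact hw v u h.symm (fun m hm => ih m (by omega)) (by tauto) (by omega)
  match u, v, h, hu with
  | [], _, _, hu => simp at hu
  | [_], _, _, hu => simp at hu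
  | _, [], h, _ => exact absurd List.nil_prefix h.2
  | x :: x' :: u, y :: v, h, hu =>
    obtain ⟨z, hzx, hzy⟩ := exists_ne_ne hd x y
    set φ := swap [x, x'] [z] (incomp_cons hzx.symm _ _)
    have hφH : φ ∈ H := hH _ _ _ (by simp) (by simp)
    have hφu := swap_shorten x' hzx.symm u
    obtain ⟨v', hv', hφv⟩ : ∃ v' : List (Fin d), v'.length ≤ (y :: v).length ∧
        ∀ w, φ (concat (y :: v) w) = concat v' w := by
      by_cases hp : [x, x'] <+: y :: v
      · obtain ⟨t, ht⟩ := hp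
        refine ⟨z :: t, by simp [← ht], fun w => ?_⟩
        rw [← ht]
        exact swap_shorten x' hzx.symm t w
      -- If `y v` were a prefix of `x x'`, it would be a prefix of the long word.
      · have hi : Incomp (y :: v) [x, x'] :=
          ⟨fun h1 => h.2 (h1.trans (List.prefix_append [x, x'] u)), hp⟩
        exact ⟨y :: v, le_rfl, fun w => swap_of_notMem _ (hi.notMem w)
          ((incomp_cons hzy.symm _ _).notMem w)⟩
    have hi' := incomp_of_conj (by omega) hφu hφv h
    have h1 := ih _ (by simp at hv' ⊢; omega) (z :: u) v' hi' rfl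
    rw [← conj_swap hφu hφv h hi'] at h1
    exact (H.mul_mem_cancel_left hφH).1 ((H.mul_mem_cancel_right (H.inv_mem hφH)).1 h1)

theorem coneMap_mem_of_short (hd : 3 ≤ d) {H : Subgroup (Boundary d ≃ₜ Boundary d)}
    (hsw : ∀ u v h, swap u v h ∈ H) (k : Boundary d ≃ₜ Boundary d)
    (hk : ∀ x, coneMap [x] k ∈ H) (u : List (Fin d)) (hu : u ≠ []) : coneMap u k ∈ H := by
  induction hn : u.length using Nat.strong_induction_on generalizing u with
  | _ n ih =>
  subst hn
  match u, hu with
  | [x], _ => exact hk x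
  | x :: x' :: u, _ =>
    obtain ⟨z, hzx, -⟩ := exists_ne_ne hd x x
    have hφu := swap_shorten x' hzx.symm u
    have h1 := ih _ (by simp) (z :: u) (by simp) rfl
    rw [← conj_coneMap hφu k] at h1
    exact (H.mul_mem_cancel_left (hsw _ _ _)).1
      ((H.mul_mem_cancel_right (H.inv_mem (hsw _ _ _))).1 h1)

theorem roverNekrashevych_fg (hd : 3 ≤ d) {G : Subgroup (TreeAut d)} (hG : IsSelfSimilar G)
    (hfg : G.FG) : (roverNekrashevych G hG).FG := by
  classical
  obtain ⟨T, rfl⟩ := hfg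
  set A : Set (Boundary d ≃ₜ Boundary d) :=
    {h | ∃ u v hi, u.length ≤ 2 ∧ v.length ≤ 2 ∧ h = swap u v hi}
  set B : Set (Boundary d ≃ₜ Boundary d) :=
    Set.image2 (fun x g => coneMap [x] (toHomeo g)) Set.univ T
  have hA : A.Finite := by
    have hf : {u : List (Fin d) | u.length ≤ 2}.Finite := List.finite_length_le _ 2
    refine ((hf.prod hf).image fun uv =>
      if hi : Incomp uv.1 uv.2 then swap uv.1 uv.2 hi else 1).subset ?_
    rintro _ ⟨u, v, hi, hu, hv, rfl⟩
    exact ⟨(u, v), ⟨hu, hv⟩, dif_pos hi⟩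
  have hB : B.Finite := Set.finite_univ.image2 _ T.finite_toSet
  refine (Subgroup.fg_iff _).2 ⟨A ∪ B, le_antisymm ?_ ?_, hA.union hB⟩
  · rw [Subgroup.closure_le]
    rintro _ (⟨u, v, hi, -, -, rfl⟩ | ⟨x, -, g, hg, rfl⟩)
    · exact swap_mem hG hi
    · exact coneMap_mem hG _ (Subgroup.subset_closure hg)
  · have hsw := swap_mem_of_short hd (H := Subgroup.closure (A ∪ B)) fun u v h hu hv =>
      Subgroup.subset_closure (Or.inl ⟨u, v, h, hu, hv, rfl⟩)
    have hletter : ∀ x, ∀ g ∈ Subgroup.closure (T : Set (TreeAut d)),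
        coneMap [x] (toHomeo g) ∈ Subgroup.closure (A ∪ B) := by
      intro x
      change Subgroup.closure (T : Set (TreeAut d)) ≤
        (Subgroup.closure (A ∪ B)).comap ((coneMap [x]).comp toHomeo)
      rw [Subgroup.closure_le]
      exact fun g hg => Subgroup.subset_closure (Or.inr ⟨x, trivial, g, hg, rfl⟩)
    refine roverNekrashevych_le (by omega) hG hsw fun u g hg => ?_
    rcases eq_or_ne u [] with rfl | hu
    · obtain ⟨τ, s, -, -, h⟩ := exists_mul_eq_coneMap
        (1 : Subgroup.closure (A ∪ B) →* Multiplicative ℤ) hsw [] g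
        fun x => hletter x _ (hG g hg [x])
      rw [← h]
      exact (τ * s).2
    · exact coneMap_mem_of_short hd hsw _ (fun x => hletter x g hg) u hu

/-! ### Finiteness of the abelianization -/

/-- Written additively, the hypothesis gives `2A ⊆ m · 2A`. By Nakayama some integer `r ≡ 1` modulo
`m` kills `2A`, and `r ≠ 0` as `m ≥ 2`. Hence `A` is torsion and finitely generated. -/
theorem finite_of_forall_eq_mul_pow {A : Type*} [CommGroup A] [Group.FG A] {m : ℕ} (hm : 2 ≤ m)
    (h : ∀ a : A, ∃ t b : A, t ^ 2 = 1 ∧ a = t * b ^ m) : Finite A := by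
  refine CommGroup.finite_of_fg_isMulTorsion A fun a => ?_
  have : Module.Finite ℤ (Additive A) := Module.Finite.iff_addGroup_fg.2 inferInstance
  let N : Submodule ℤ (Additive A) := LinearMap.range (LinearMap.lsmul ℤ (Additive A) 2)
  have hN : N.FG := IsNoetherian.noetherian N
  have hle : N ≤ Ideal.span {(m : ℤ)} • N := by
    rintro _ ⟨a, rfl⟩
    obtain ⟨t, b, ht, hab⟩ := h a.toMul
    have h1 : (2 : ℤ) • a = (m : ℤ) • ((2 : ℤ) • Additive.ofMul b) := by
      apply Additive.toMul.injective
      change a.toMul ^ (2 : ℤ) = (b ^ (2 : ℤ)) ^ (m : ℤ)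
      rw [hab]
      norm_cast
      rw [mul_pow, ht, one_mul, ← pow_mul, ← pow_mul, mul_comm]
    change (2 : ℤ) • a ∈ _
    rw [h1]
    exact Submodule.smul_mem_smul (Ideal.mem_span_singleton_self _) ⟨Additive.ofMul b, rfl⟩
  obtain ⟨r, hr1, hr⟩ := Submodule.exists_sub_one_mem_and_smul_eq_zero_of_fg_of_le_smul _ N hN hle
  have hr0 : r ≠ 0 := by
    rintro rfl
    rw [Ideal.mem_span_singleton, zero_sub, dvd_neg] at hr1
    have := Int.eq_one_of_dvd_one (by positivity) hr1
    omega
  rw [isOfFinOrder_iff_zpow_eq_one]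
  exact ⟨2 * r, mul_ne_zero two_ne_zero hr0, by
    rw [zpow_mul]; exact hr _ ⟨Additive.ofMul a, rfl⟩⟩

/-- Copies on incomparable cones are conjugate by a swap. Comparable cones are handled through the
cone of a third letter, incomparable with both. -/
theorem map_coneMap_eq (hd : 3 ≤ d) {H : Subgroup (Boundary d ≃ₜ Boundary d)} {A : Type*}
    [CommGroup A] (φ : H →* A) (hsw : ∀ u v h, swap u v h ∈ H) {k : Boundary d ≃ₜ Boundary d}
    (hk : ∀ u, coneMap u k ∈ H) {u : List (Fin d)} (hu : u ≠ []) (x : Fin d) :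
    φ ⟨_, hk u⟩ = φ ⟨_, hk [x]⟩ := by
  have key : ∀ a b, Incomp a b → φ ⟨_, hk a⟩ = φ ⟨_, hk b⟩ := by
    intro a b hab
    have h1 : (⟨_, hk b⟩ : H) = ⟨_, hsw a b hab⟩ * ⟨_, hk a⟩ * (⟨_, hsw a b hab⟩)⁻¹ :=
      Subtype.ext (conj_coneMap (swap_left hab) k).symm
    rw [h1, map_mul, map_mul, map_inv, mul_inv_cancel_comm]
  obtain ⟨y, u, rfl⟩ := List.exists_cons_of_ne_nil hu
  obtain ⟨z, hzx, hzy⟩ := exists_ne_ne hd x y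
  rw [key _ _ (incomp_cons hzy.symm u []), key _ _ (incomp_cons hzx [] [])]

/-- The equivalence `e` groups the letters into classes of size `m` on which first-level states
agree; this repetition produces the `m`-th powers. -/
theorem finite_abelianization (hd : 3 ≤ d) {G : Subgroup (TreeAut d)} (hG : IsSelfSimilar G)
    (hfg : G.FG) {ι : Type*} [Fintype ι] {m : ℕ} (hm : 2 ≤ m) (e : Fin m × ι ≃ Fin d)
    (he : ∀ g ∈ G, ∀ k k' x, g.state [e (k, x)] = g.state [e (k', x)]) :
    Finite (Abelianization (roverNekrashevych G hG)) := by
  set Γ := roverNekrashevych G hG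
  let φ : Γ →* Abelianization Γ := Abelianization.of
  have hφ : Function.Surjective φ := QuotientGroup.mk_surjective
  have : Group.FG Γ := (Group.fg_iff_subgroup_fg _).2 (roverNekrashevych_fg hd hG hfg)
  have : Group.FG (Abelianization Γ) := Group.fg_of_surjective hφ
  have hsw : ∀ u v h, swap u v h ∈ Γ := fun u v h => swap_mem hG h
  let K : Subgroup (Abelianization Γ) :=
    (powMonoidHom 2 : Abelianization Γ →* _).ker ⊔ (powMonoidHom m : Abelianization Γ →* _).range
  -- It suffices to place the images of the generators in `K`, the products of an element killed by
  -- 2 and an `m`-th power.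
  have hle : Γ ≤ (K.comap φ).map Γ.subtype := by
    refine roverNekrashevych_le (by omega) hG (fun u v h => ?_) fun u g hg => ?_
    · refine ⟨⟨_, hsw u v h⟩, (le_sup_left : _ ≤ K) ?_, rfl⟩
      change φ _ ^ 2 = 1
      rw [← map_pow, sq, ← map_one φ]
      exact congrArg φ (Subtype.ext (swap_mul_self h))
    · obtain ⟨τ, s, hτ, hs, hτs⟩ := exists_mul_eq_coneMap φ hsw u g
        fun x => coneMap_mem hG _ (hG g hg [x])
      refine ⟨τ * s, (K.comap φ).mul_mem ((le_sup_left : _ ≤ K) hτ)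
        ((le_sup_right : _ ≤ K) ?_), hτs⟩
      have hm0 : 0 < m := by omega
      let x₀ : Fin d := ⟨0, by omega⟩
      -- The `m`-th root takes one state from each class of letters, all moved to the single cone of
      -- `x₀`.
      refine ⟨∏ x, φ ⟨_, coneMap_mem hG [x₀] (hG g hg [e (⟨0, hm0⟩, x)])⟩, ?_⟩
      rw [powMonoidHom_apply, hs, ← e.prod_comp, Fintype.prod_prod_type_right, ← Finset.prod_pow]
      refine Finset.prod_congr rfl fun x _ => ?_
      rw [Finset.prod_eq_pow_card (b := φ ⟨_, coneMap_mem hG [x₀] (hG g hg [e (⟨0, hm0⟩, x)])⟩),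
        Finset.card_univ, Fintype.card_fin]
      intro k _
      rw [map_coneMap_eq hd φ hsw (fun v => coneMap_mem hG v (hG g hg [e (k, x)]))
        (by simp) x₀]
      simp only [he g hg k ⟨0, hm0⟩ x]
  refine finite_of_forall_eq_mul_pow hm fun a => ?_
  obtain ⟨h, rfl⟩ := hφ a
  obtain ⟨h', hh', heq⟩ := hle h.2
  rw [Subtype.ext heq] at hh'
  obtain ⟨t, ht, _, ⟨b, rfl⟩, hb⟩ := Subgroup.mem_sup.1 (show φ h ∈ K from hh')
  exact ⟨t, b, ht, hb.symm⟩

/-! ### Word lengths -/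

section wordLength

variable {Γ : Type*} [Group Γ] {S : Set Γ}

theorem wordLength_spec (hS : Subgroup.closure S = ⊤) (g : Γ) :
    ∃ l : List Γ, l.length = wordLength S g ∧ (∀ x ∈ l, x ∈ S ∨ x⁻¹ ∈ S) ∧ l.prod = g := by
  have hne : {n | ∃ l : List Γ, l.length = n ∧ (∀ x ∈ l, x ∈ S ∨ x⁻¹ ∈ S) ∧
      l.prod = g}.Nonempty := by
    have hg : g ∈ (Subgroup.closure S).toSubmonoid := by rw [hS]; trivial
    rw [Subgroup.closure_toSubmonoid] at hg
    obtain ⟨l, hl, hp⟩ := Submonoid.exists_list_of_mem_closure hg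
    exact ⟨l.length, l, rfl, hl, hp⟩
  exact Nat.sInf_mem hne

theorem wordLength_le {l : List Γ} (hl : ∀ x ∈ l, x ∈ S ∨ x⁻¹ ∈ S) :
    wordLength S l.prod ≤ l.length := Nat.sInf_le ⟨l, rfl, hl, rfl⟩

theorem wordLength_one : wordLength S 1 = 0 :=
  Nat.le_zero.1 (wordLength_le (l := []) (by simp))

theorem wordLength_mul_le (hS : Subgroup.closure S = ⊤) (g h : Γ) :
    wordLength S (g * h) ≤ wordLength S g + wordLength S h := by
  obtain ⟨l, hl, hl1, rfl⟩ := wordLength_spec hS g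
  obtain ⟨k, hk, hk1, rfl⟩ := wordLength_spec hS h
  rw [← hl, ← hk, ← List.prod_append, ← List.length_append]
  refine wordLength_le fun x hx => ?_
  rcases List.mem_append.1 hx with hx | hx
  · exact hl1 x hx
  · exact hk1 x hx

/-- A map is coarse Lipschitz if multiplying the argument by a generator on the right multiplies
the value on the right by an element of a finite set. -/
theorem coarseLipschitz_of_finite (hS : Subgroup.closure S = ⊤) {Q : Type*} [Group Q] {T : Set Q}
    (hT : Subgroup.closure T = ⊤) {ρ : Γ → Q} {F : Set Q} (hF : F.Finite)
    (h : ∀ g s, s ∈ S ∨ s⁻¹ ∈ S → (ρ g)⁻¹ * ρ (g * s) ∈ F) :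
    CoarseLipschitz (wordDist S) (wordDist T) ρ := by
  obtain ⟨C, hC⟩ := (hF.image (wordLength T)).bddAbove
  -- The increment of `ρ` along a word telescopes into one-letter increments, each of length at most
  -- `C`.
  have key : ∀ (l : List Γ), (∀ x ∈ l, x ∈ S ∨ x⁻¹ ∈ S) → ∀ g,
      wordLength T ((ρ g)⁻¹ * ρ (g * l.prod)) ≤ C * l.length := by
    intro l
    induction l with
    | nil => intro _ g; simp [wordLength_one]
    | cons s l ih =>
      intro hl g
      have h1 : (ρ g)⁻¹ * ρ (g * (s :: l).prod) =
          ((ρ g)⁻¹ * ρ (g * s)) * ((ρ (g * s))⁻¹ * ρ (g * s * l.prod)) := by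
        rw [List.prod_cons, mul_assoc g]
        group
      have h2 : wordLength T ((ρ g)⁻¹ * ρ (g * s)) ≤ C :=
        hC ⟨_, h g s (hl s List.mem_cons_self), rfl⟩
      have h3 := ih (fun x hx => hl x (List.mem_cons_of_mem _ hx)) (g * s)
      rw [h1, List.length_cons, mul_add, mul_one]
      exact (wordLength_mul_le hT _ _).trans (by omega)
  refine ⟨C + 1, by positivity, 1, one_pos, fun x y => ?_⟩
  obtain ⟨l, hl, hl1, hl2⟩ := wordLength_spec hS (x⁻¹ * y)
  have h1 := key l hl1 x
  rw [hl2, mul_inv_cancel_left, hl] at h1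
  have h2 : (wordLength T ((ρ x)⁻¹ * ρ y) : ℝ) ≤ C * wordLength S (x⁻¹ * y) := by exact_mod_cast h1
  have h3 : (0 : ℝ) ≤ wordLength S (x⁻¹ * y) := by positivity
  simp only [wordDist]
  linarith

end wordLength

/-! ### The germ cocycle of a persistent homomorphism -/

variable {Q : Type*} [Group Q]

theorem treeAut_ext_of_onBoundary (hd : 0 < d) {f g : TreeAut d}
    (h : ∀ w, f.onBoundary w = g.onBoundary w) : f = g := by
  ext1 u
  have h1 : pre (concat u fun _ => ⟨0, hd⟩) u.length = u := mem_cone_iff.1 (concat_mem_cone _ _)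
  rw [← h1, ← pre_onBoundary, ← pre_onBoundary, h]

theorem pre_add (w : Boundary d) (m n : ℕ) : pre w (m + n) = pre w m ++ pre (tail w m) n := by
  have h := pre_concat (pre w m) (tail w m) n
  rw [length_pre] at h
  rw [← h]
  exact congrArg (fun z => pre z (m + n)) (concat_pre w m).symm

/-- Near `w`, the map `h` acts by an element of `G`, up to a change of prefix, on which the
homomorphism `r` takes the value `q`. -/
def HasGerm (r : G →* Q) (h : Boundary d → Boundary d) (w : Boundary d) (q : Q) : Prop :=
  ∃ (N : ℕ) (v : List (Fin d)) (g : G), r g = q ∧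
    ∀ z, h (concat (pre w N) z) = concat v (TreeAut.onBoundary (g : TreeAut d) z)

variable {hG : IsSelfSimilar G} {r : G →* Q} {h k : Boundary d → Boundary d} {w : Boundary d}
  {p q : Q}

/-- On a smaller cone the label becomes a state, on which `r` is unchanged by persistence. The bound
`n ≤ v'.length` lets germs be matched in compositions. -/
theorem HasGerm.exists_deeper (hr : IsPersistent hG r) {N : ℕ} {v : List (Fin d)} {g : G}
    (hv : ∀ z, h (concat (pre w N) z) = concat v (TreeAut.onBoundary (g : TreeAut d) z)) (n : ℕ) :
    ∃ (v' : List (Fin d)) (g' : G), n ≤ v'.length ∧ r g' = r g ∧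
      ∀ z, h (concat (pre w (N + n)) z) = concat v' (TreeAut.onBoundary (g' : TreeAut d) z) := by
  refine ⟨v ++ (g : TreeAut d) (pre (tail w N) n), ⟨_, hG g g.2 (pre (tail w N) n)⟩, ?_, hr _ _,
    fun z => ?_⟩
  · simp [TreeAut.length_map, length_pre]
  · rw [pre_add, concat_append, hv, onBoundary_concat, concat_append]

/-- At a common depth the two image prefixes are comparable. Labels act surjectively on the
boundary, so the prefixes coincide, and then so do the labels by faithfulness of the boundary
action. -/
theorem HasGerm.unique (hd : 2 ≤ d) (hr : IsPersistent hG r) (hp : HasGerm r h w p)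
    (hq : HasGerm r h w q) : p = q := by
  obtain ⟨N, v, f, rfl, hv⟩ := hp
  obtain ⟨M, u, g, rfl, hu⟩ := hq
  obtain ⟨v, f', -, hf, hv⟩ := HasGerm.exists_deeper hr hv M
  obtain ⟨u, g', -, hg, hu⟩ := HasGerm.exists_deeper hr hu N
  rw [← hf, ← hg]
  clear hf hg
  rw [add_comm] at hu
  wlog hl : v.length ≤ u.length generalizing u v f' g'
  · exact (this u g' hu v f' hv (by omega)).symm
  obtain ⟨t, rfl⟩ := prefix_of_concat_eq ((hv w).symm.trans (hu w)) hl
  have h1 : ∀ z, TreeAut.onBoundary (f' : TreeAut d) z =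
      concat t (TreeAut.onBoundary (g' : TreeAut d) z) := fun z =>
    concat_injective v (by rw [← hv, hu, concat_append])
  cases t with
  | nil =>
    refine congrArg r (Subtype.ext (treeAut_ext_of_onBoundary (by omega) fun z => ?_))
    rw [h1, concat_nil]
  | cons x t =>
    have : Nontrivial (Fin d) := Fin.nontrivial_iff_two_le.2 hd
    obtain ⟨y, hy⟩ := exists_ne x
    have h2 := h1 ((toHomeo (f' : TreeAut d)).symm fun _ => y)
    rw [← toHomeo_apply, Homeomorph.apply_symm_apply] at h2
    have h3 := congrFun h2 0
    simp [concat] at h3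
    exact absurd h3 hy

theorem HasGerm.comp (hr : IsPersistent hG r) (hq : HasGerm r h (k w) q) (hp : HasGerm r k w p) :
    HasGerm r (h ∘ k) w (q * p) := by
  obtain ⟨N, v, f, rfl, hv⟩ := hp
  obtain ⟨M, u, g, rfl, hu⟩ := hq
  -- The inner map is refined until its image prefix `v` has length at least `M`; the outer germ is
  -- then refined to depth exactly `v.length`.
  obtain ⟨v, f', hl, hf, hv⟩ := HasGerm.exists_deeper hr hv M
  obtain ⟨u, g', -, hg, hu⟩ := HasGerm.exists_deeper hr hu (v.length - M)
  rw [Nat.add_sub_cancel' hl] at hu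
  have hkw : pre (k w) v.length = v := by
    rw [← mem_cone_iff, ← concat_pre w (N + M), hv]
    exact concat_mem_cone _ _
  rw [hkw] at hu
  refine ⟨N + M, u, g' * f', by rw [map_mul, hf, hg], fun z => ?_⟩
  rw [Function.comp_apply, hv, hu, ← onBoundary_mul]
  rfl

theorem hasGerm_toHomeo (r : G →* Q) (g : G) (w : Boundary d) :
    HasGerm r (toHomeo (g : TreeAut d)) w (r g) :=
  ⟨0, [], g, rfl, fun z => by rw [pre, List.range_zero, List.map_nil, concat_nil, concat_nil]; rfl⟩

theorem exists_finite_hasGerm (hG : IsSelfSimilar G) (r : G →* Q) {h : Boundary d ≃ₜ Boundary d}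
    (hh : h ∈ roverNekrashevych G hG) : ∃ F : Set Q, F.Finite ∧ ∀ w, ∃ q ∈ F, HasGerm r h w q := by
  obtain ⟨N, hN⟩ := IsAlmostAut.exists_isLocal hG hh
  choose v g hg hv using fun a : Fin N → Fin d => hN (List.ofFn a) (by simp)
  refine ⟨Set.range fun a => r ⟨g a, hg a⟩, Set.finite_range _, fun w => ?_⟩
  have hw : pre w N = List.ofFn fun i : Fin N => w i :=
    List.ext_getElem (by simp [pre]) fun i h1 h2 => by simp [pre]
  exact ⟨_, ⟨fun i : Fin N => w i, rfl⟩, N, v _, ⟨_, hg _⟩, rfl, fun z => by rw [hw, hv]⟩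

theorem toHomeo_mem (hG : IsSelfSimilar G) {g : TreeAut d} (hg : g ∈ G) :
    toHomeo g ∈ roverNekrashevych G hG := by
  rw [← coneMap_nil (toHomeo g)]
  exact coneMap_mem hG _ hg

/-- A persistent retract of a self-similar group is a quasi-retract of the
Röver–Nekrashevych group. -/
theorem isQuasiRetract_of_isPersistent (hd : 2 ≤ d) (hr : IsPersistent hG r)
    (hret : IsRetraction r) (hfg : (roverNekrashevych G hG).FG) [Group.FG Q] :
    IsQuasiRetract (roverNekrashevych G hG) Q := by
  set Γ := roverNekrashevych G hG
  obtain ⟨S, hS, hSfin⟩ := Group.fg_iff.1 ((Group.fg_iff_subgroup_fg _).2 hfg)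
  obtain ⟨T, hT, hTfin⟩ := Group.fg_iff.1 ‹Group.FG Q›
  obtain ⟨i, hi⟩ := hret
  choose F hF hFg using fun h : Γ => exists_finite_hasGerm hG r h.2
  choose c hcF hc using hFg
  have hmul : ∀ (h k : Γ) w, c (h * k) w = c h (k.1 w) * c k w := fun h k w =>
    (hc (h * k) w).unique hd hr ((hc h (k.1 w)).comp hr (hc k w) :)
  let w₀ : Boundary d := fun _ => ⟨0, by omega⟩
  let ι : Q →* Γ := (toHomeo.comp (G.subtype.comp i)).codRestrict Γ
    fun q => toHomeo_mem hG (i q).2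
  -- The two inversions turn the cocycle rule into `ρ (g * s) = ρ g * (c s⁻¹ (g⁻¹ w₀))⁻¹`, whose
  -- last factor ranges over a finite set for each generator `s`. Moreover `ρ ∘ ι` is the identity,
  -- so `1` is just a positive constant.
  refine ⟨S, T, hSfin, hS, hTfin, hT, fun h => (c h⁻¹ w₀)⁻¹, ?_, ι, ?_, 1, one_pos, fun q => ?_⟩
  · refine coarseLipschitz_of_finite hS hT (F := ⋃ s ∈ S ∪ S⁻¹, (F s⁻¹)⁻¹)
      ((hSfin.union hSfin.inv).biUnion fun s _ => (hF _).inv) fun g s hs => ?_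
    refine Set.mem_biUnion (show s ∈ S ∪ S⁻¹ from hs) ?_
    rw [mul_inv_rev, hmul, mul_inv_rev, inv_inv, mul_inv_cancel_left, Set.inv_mem_inv]
    exact hcF _ _
  · refine coarseLipschitz_of_finite hT hS (F := ι '' (T ∪ T⁻¹))
      ((hTfin.union hTfin.inv).image _) fun g s hs => ?_
    rw [map_mul, inv_mul_cancel_left]
    exact ⟨s, hs, rfl⟩
  · have h1 : c (ι q)⁻¹ w₀ = q⁻¹ := by
      rw [← map_inv]
      refine (hc _ _).unique hd hr ?_
      have h2 := hasGerm_toHomeo r (i q⁻¹) w₀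
      rwa [show r (i q⁻¹) = q⁻¹ from DFunLike.congr_fun hi q⁻¹] at h2
    change wordDist T (c (ι q)⁻¹ w₀)⁻¹ q ≤ 1
    rw [wordDist, h1, inv_inv, inv_mul_cancel, wordLength_one]
    simp

theorem isQuasiRetract_of_subsingleton (Γ Q : Type*) [Group Γ] [Group Q] [Subsingleton Γ]
    [Subsingleton Q] : IsQuasiRetract Γ Q :=
  ⟨∅, ∅, Set.finite_empty, Subsingleton.elim _ _, Set.finite_empty, Subsingleton.elim _ _, 1,
    coarseLipschitz_of_finite (Subsingleton.elim _ _) (Subsingleton.elim _ _) Set.finite_univ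
      fun _ _ _ => trivial, 1,
    coarseLipschitz_of_finite (Subsingleton.elim _ _) (Subsingleton.elim _ _) Set.finite_univ
      fun _ _ _ => trivial, 1, one_pos, fun q => by
    rw [Subsingleton.elim q 1]; simp [wordDist, wordLength_one]⟩

/-! ### Enlarging the alphabet -/

section lift

variable {m : ℕ}

/-- The action on words over `Fin m × Fin d` through the second coordinate. -/
def liftFun (f : List (Fin d) → List (Fin d)) (u : List (Fin (m * d))) : List (Fin (m * d)) :=
  List.zipWith (fun a y => finProdFinEquiv ((finProdFinEquiv.symm a).1, y)) u
    (f (u.map fun a => (finProdFinEquiv.symm a).2))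

/-- The word of second coordinates. -/
def sndWord (u : List (Fin (m * d))) : List (Fin d) := u.map fun a => (finProdFinEquiv.symm a).2

/-- The word of first coordinates. -/
def fstWord (u : List (Fin (m * d))) : List (Fin m) := u.map fun a => (finProdFinEquiv.symm a).1

/-- Identities for `lift` are checked on the two coordinate words: it fixes the first and applies
`f` to the second. -/
theorem word_ext {u v : List (Fin (m * d))} (h₁ : fstWord u = fstWord v)
    (h₂ : sndWord u = sndWord v) : u = v := by
  have hl : u.length = v.length := by simpa [fstWord] using congrArg List.length h₁
  refine List.ext_getElem hl fun i hu hv => finProdFinEquiv.symm.injective (Prod.ext ?_ ?_)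
  · simpa [fstWord, hu, hv] using congrArg (fun l => l[i]?) h₁
  · simpa [sndWord, hu, hv] using congrArg (fun l => l[i]?) h₂

theorem fstWord_append (u v : List (Fin (m * d))) : fstWord (u ++ v) = fstWord u ++ fstWord v :=
  List.map_append

theorem sndWord_append (u v : List (Fin (m * d))) : sndWord (u ++ v) = sndWord u ++ sndWord v :=
  List.map_append

theorem fstWord_singleton (x : Fin m) (y : Fin d) : fstWord [finProdFinEquiv (x, y)] = [x] := by
  simp [fstWord, -finProdFinEquiv_symm_apply]

theorem sndWord_singleton (x : Fin m) (y : Fin d) : sndWord [finProdFinEquiv (x, y)] = [y] := by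
  simp [sndWord, -finProdFinEquiv_symm_apply]

theorem fstWord_liftFun (f : TreeAut d) (u : List (Fin (m * d))) :
    fstWord (liftFun f u) = fstWord u :=
  List.ext_getElem (by simp [fstWord, liftFun, f.length_map]) fun i h1 h2 => by
    simp [fstWord, liftFun, -finProdFinEquiv_symm_apply]

theorem sndWord_liftFun (f : TreeAut d) (u : List (Fin (m * d))) :
    sndWord (liftFun f u) = f (sndWord u) :=
  List.ext_getElem (by simp [sndWord, liftFun, f.length_map]) fun i h1 h2 => by
    simp [sndWord, liftFun, -finProdFinEquiv_symm_apply]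

theorem liftFun_mul (f g : TreeAut d) (u : List (Fin (m * d))) :
    liftFun (f * g) u = liftFun f (liftFun g u) :=
  word_ext (by simp only [fstWord_liftFun]) (by simp only [sndWord_liftFun, RelIso.mul_apply])

theorem liftFun_one (u : List (Fin (m * d))) : liftFun (1 : TreeAut d) u = u :=
  word_ext (by simp only [fstWord_liftFun]) (by simp only [sndWord_liftFun, RelIso.one_apply])

theorem liftFun_edge (f : TreeAut d) {u v : List (Fin (m * d))} (h : TreeEdge (m * d) u v) :
    TreeEdge (m * d) (liftFun f u) (liftFun f v) := by
  obtain ⟨a, rfl⟩ := h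
  obtain ⟨⟨x, y⟩, rfl⟩ := finProdFinEquiv.surjective a
  obtain ⟨z, hz⟩ := f.edge (sndWord u) y
  refine ⟨finProdFinEquiv (x, z), word_ext ?_ ?_⟩
  · simp only [fstWord_liftFun, fstWord_append, fstWord_singleton]
  · simp only [sndWord_liftFun, sndWord_append, sndWord_singleton, hz]

variable (m) in
/-- The homomorphism `Aut(T_d) → Aut(T_{md})` acting through the second coordinate. -/
def lift : TreeAut d →* TreeAut (m * d) where
  toFun f :=
    { toFun := liftFun f
      invFun := liftFun (f⁻¹ : TreeAut d)
      left_inv := fun u => by rw [← liftFun_mul, inv_mul_cancel, liftFun_one]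
      right_inv := fun u => by rw [← liftFun_mul, mul_inv_cancel, liftFun_one]
      map_rel_iff' := fun {u v} => by
        refine ⟨fun h => ?_, liftFun_edge f⟩
        have h1 := liftFun_edge f⁻¹ h
        simp only [Equiv.coe_fn_mk] at h1
        rwa [← liftFun_mul, ← liftFun_mul, inv_mul_cancel, liftFun_one, liftFun_one] at h1 }
  map_one' := RelIso.ext liftFun_one
  map_mul' f g := RelIso.ext (liftFun_mul f g)

theorem fstWord_lift (f : TreeAut d) (u : List (Fin (m * d))) :
    fstWord (lift m f u) = fstWord u := fstWord_liftFun f u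

theorem sndWord_lift (f : TreeAut d) (u : List (Fin (m * d))) :
    sndWord (lift m f u) = f (sndWord u) := sndWord_liftFun f u

theorem lift_injective (hm : 0 < m) : Function.Injective (lift (d := d) m) := by
  intro f g h
  refine RelIso.ext fun u => ?_
  have h1 : sndWord (u.map fun y => finProdFinEquiv ((⟨0, hm⟩ : Fin m), y)) = u := by
    simp [sndWord, Function.comp_def, -finProdFinEquiv_symm_apply]
  rw [← h1, ← sndWord_lift, h, sndWord_lift]

theorem state_lift (f : TreeAut d) (u : List (Fin (m * d))) :
    (lift m f).state u = lift m (f.state (sndWord u)) := by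
  refine RelIso.ext fun v => ?_
  have h := (lift m f).state_spec u v
  refine word_ext ?_ ?_
  · have h1 := congrArg fstWord h
    rw [fstWord_lift, fstWord_append, fstWord_append, fstWord_lift] at h1
    rw [fstWord_lift, List.append_cancel_left h1]
  · have h1 := congrArg sndWord h
    rw [sndWord_lift, sndWord_append, sndWord_append, sndWord_lift, f.state_spec] at h1
    rw [sndWord_lift, List.append_cancel_left h1]

end lift

end SelfSim

theorem corollary5p3 {d : ℕ} (G : Subgroup (TreeAut d)) (hfg : G.FG) (hG : IsSelfSimilar G)
    {Q : Type*} [Group Q] (r : G →* Q) (hr : IsRetraction r) (hpers : IsPersistent hG r) :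
    ∃ m : ℕ, 0 < m ∧ ∃ j : G →* TreeAut (m * d), Function.Injective j ∧
      ∃ hj : IsSelfSimilar j.range,
        Finite (Abelianization (roverNekrashevych j.range hj)) ∧
        IsQuasiRetract (roverNekrashevych j.range hj) Q := by
  have : Group.FG G := (Group.fg_iff_subgroup_fg _).2 hfg
  have hrsurj : Function.Surjective r := by
    obtain ⟨i, hi⟩ := hr
    exact fun q => ⟨i q, DFunLike.congr_fun hi q⟩
  have : Group.FG Q := Group.fg_of_surjective hrsurj
  let j : G →* TreeAut (3 * d) := (lift 3).comp G.subtype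
  have hinj : Function.Injective j := (lift_injective (by norm_num)).comp Subtype.val_injective
  have hj : IsSelfSimilar j.range := by
    rintro _ ⟨g, rfl⟩ u
    exact ⟨⟨_, hG g g.2 (sndWord u)⟩, (state_lift _ u).symm⟩
  -- For `d > 0` the factor 3 gives at least three letters, and it exceeds 1 as the abelianization
  -- argument requires. Finite generation of the new group is part of `IsQuasiRetract`.
  refine ⟨3, by norm_num, j, hinj, hj, ?_⟩
  -- With no letters the boundary is empty and the tree is a single vertex, so all groups involved
  -- are trivial.
  rcases Nat.eq_zero_or_pos d with rfl | hd
  · have hE : IsEmpty (Boundary (3 * 0)) := ⟨fun w => (w 0).elim0⟩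
    have hΓ : Subsingleton (roverNekrashevych j.range hj) :=
      ⟨fun a b => Subtype.ext (Homeomorph.ext fun w => hE.elim w)⟩
    have hQ : Subsingleton Q := by
      have : Subsingleton G := ⟨fun a b => Subtype.ext (RelIso.ext fun u =>
        Subsingleton.elim _ _)⟩
      exact hrsurj.subsingleton
    exact ⟨Finite.of_surjective _ QuotientGroup.mk_surjective,
      isQuasiRetract_of_subsingleton _ _⟩
  · have hjfg : j.range.FG := (Group.fg_iff_subgroup_fg _).1
      (Group.fg_of_surjective j.rangeRestrict_surjective)
    let e : G ≃* j.range := MonoidHom.ofInjective hinj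
    refine ⟨finite_abelianization (by omega) hj hjfg (m := 3) (by norm_num) finProdFinEquiv ?_, ?_⟩
    · rintro _ ⟨g, rfl⟩ k k' x
      change (lift 3 g.1).state _ = (lift 3 g.1).state _
      rw [state_lift, state_lift, sndWord_singleton, sndWord_singleton]
    · refine isQuasiRetract_of_isPersistent (r := r.comp e.symm.toMonoidHom) (by omega) ?_ ?_
        (roverNekrashevych_fg (by omega) hj hjfg)
      · intro g u
        obtain ⟨g, rfl⟩ := e.surjective g
        have h1 : (⟨(e g : TreeAut (3 * d)).state u, hj _ (e g).2 u⟩ : j.range) =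
            e ⟨_, hG g g.2 (sndWord u)⟩ := Subtype.ext (state_lift g.1 u)
        rw [h1]
        simpa using hpers g (sndWord u)
      · obtain ⟨i, hi⟩ := hr
        refine ⟨e.toMonoidHom.comp i, MonoidHom.ext fun q => ?_⟩
        simpa using DFunLike.congr_fun hi q
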